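/- Let $n\in\mathbb N$. All sheaves are sheaves of real vector spaces on $\mathbb R^n$, and a sheaf morphism is a natural transformation (linear on sections, commuting with restrictions). Let $\mathcal C^0$ be the sheaf of continuous real functions. For $k=1,\dots,n$ let $\mathcal C^1_k\subseteq\mathcal C^0$ be the subsheaf of those $f\in\mathcal C^0(U)$ such that for every $x\in U$ the function $t\mapsto f(x_1,\dots,x_{k-1},t,x_{k+1},\dots,x_n)$ is $C^1$ on the open set $\{t\in\mathbb R: (x_1,\dots,x_{k-1},t,x_{k+1},\dots,x_n)\in U\}$ and $\partial_k f$ is continuous on $U$; let $\iota_k,\partial_k:\mathcal C^1_k\to\mathcal C^0$ be the inclusion and the partial derivative. Let $\mathcal D'$ be the sheaf of real-valued Schwartz distributions, $\lambda:\mathcal C^0\to\mathcal D'$, $\lambda_U(f)(\varphi)=\int_U f\varphi\,dx$, the usual embedding, and $D_k:\mathcal D'\to\mathcal D'$, $(D_kT)(\varphi)=-T(\partial_k\varphi)$, the distributional partial derivatives. An $n$-dimensional interval is an open set $(c_1-r,c_1+r)\times\dots\times(c_n-r,c_n+r)$ with $c\in\mathbb R^n$, $r>0$. Consider triples $(H,j,(\delta_k)_{k=1}^n)$.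 Such a triple is called a solution of the problem $\mathcal P$ if: 1. $H$ is a sheaf of real vector spaces on $\mathbb R^n$; 2. $j:\mathcal C^0\to H$ is a sheaf morphism; 3. $\delta_k:H\to H$ are sheaf morphisms and $\delta_k\circ j\circ\iota_k=j\circ\partial_k$ for all $k=1,\dots,n$; 4. for every $\alpha\in\mathbb N^n$, every $n$-dimensional interval $U$ and every $f\in\mathcal C^0(U)$ of the form $f=\theta_1+\dots+\theta_n$, where each $\theta_k\in\mathcal C^0(U)$ is a polynomial in $x_k$ of degree $<\alpha_k$ (so $\theta_k=0$ if $\alpha_k=0$) whose coefficients are continuous functions on $U$ independent of $x_k$, one has $\delta^\alpha_U(j_U(f))=0$, where $\delta^\alpha:=\delta_1^{\alpha_1}\circ\dots\circ\delta_n^{\alpha_n}$; 5. $\delta_h\circ\delta_k=\delta_k\circ\delta_h$ for all $h,k=1,\dots,n$. A sheaf morphism $\psi:H\to\overline H$ between the sheaves of two triples has the property $\mathcal Q$ (with respect to $(H,j,(\delta_k)_k)$ and $(\overline H,\overline\jmath,(\overline\delta_k)_k)$) if $\psi\circ j=\overline\jmath$ and $\psi\circ\delta_k=\overline\delta_k\circ\psi$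 for all $k=1,\dots,n$. **Theorem.** $(\mathcal D',\lambda,(D_k)_k)$ is a co-universal solution of $\mathcal P$ with respect to $\mathcal Q$. That is: the property $\mathcal Q$ holds for identities and is stable under composition; $(\mathcal D',\lambda,(D_k)_k)$ is a solution of $\mathcal P$; and for every solution $(H,j,(\delta_k)_k)$ of $\mathcal P$ there is exactly one sheaf morphism $\psi:\mathcal D'\to H$ such that $$\psi\circ\lambda=j,\qquad \psi\circ D_k=\delta_k\circ\psi\quad\text{for all }k=1,\dots,n.$$ -/

import Mathlib

open CategoryTheory TopologicalSpace Opposite MeasureTheory Set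
open scoped Distributions CompactConvergenceCLM

universe u v w

noncomputable section

namespace UnivDistr

/-! ## Co-universal solutions -/

/-- `X` is a co-universal solution of the problem `P` with respect to the property `Q` of arrows:
`Q` is stable under composition and identities, `X` solves `P`, and every solution `Y` of `P`
receives exactly one arrow from `X` having the property `Q`. -/
structure IsCoUniversalSolution {C : Type w} [Category.{v} C] (P : C → Prop)
    (Q : ∀ ⦃A B : C⦄, (A ⟶ B) → Prop) (X : C) : Prop where
  comp : ∀ ⦃A B D : C⦄ (f : A ⟶ B) (g : B ⟶ D), Q f → Q g → Q (f ≫ g)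
  id : ∀ A : C, Q (𝟙 A)
  solution : P X
  existsUnique : ∀ Y : C, P Y → ∃! φ : X ⟶ Y, Q φ

variable {n : ℕ}

/-! ## Continuous functions on open subsets of `ℝⁿ` -/

/-- The topological space `ℝⁿ`. (Only its topology, its linear structure and its Lebesgue measure
are used, so the choice of norm is irrelevant.) -/
abbrev Rn (n : ℕ) : TopCat.{0} := TopCat.of (Fin n → ℝ)

/-- Restriction of continuous functions from `U` to `V ⊆ U`. -/
def contRes {U V : Opens (Fin n → ℝ)} (h : V ≤ U) : C(U, ℝ) →ₗ[ℝ] C(V, ℝ) where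
  toFun f := ⟨fun x => f ⟨x.1, h x.2⟩, by fun_prop⟩
  map_add' _ _ := rfl
  map_smul' _ _ := rfl

/-- The (pre)sheaf `𝒞⁰` of continuous real functions on `ℝⁿ`. -/
def C0 (n : ℕ) : TopCat.Presheaf (ModuleCat.{0} ℝ) (Rn n) where
  obj U := ModuleCat.of ℝ C((U.unop : Opens (Fin n → ℝ)), ℝ)
  map i := ModuleCat.ofHom (contRes i.unop.le)
  map_id _ := rfl
  map_comp _ _ := rfl

/-- Auxiliary extension by `0` of a function on `U` to the whole of `ℝⁿ`. -/
def zeroExt {U : Opens (Fin n → ℝ)} (f : C(U, ℝ)) : (Fin n → ℝ) → ℝ :=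
  Function.extend Subtype.val f 0

theorem zeroExt_apply {U : Opens (Fin n → ℝ)} (f : C(U, ℝ)) {x : Fin n → ℝ} (hx : x ∈ U) :
    zeroExt f x = f ⟨x, hx⟩ :=
  Subtype.val_injective.extend_apply f 0 ⟨x, hx⟩

theorem zeroExt_of_notMem {U : Opens (Fin n → ℝ)} (f : C(U, ℝ)) {x : Fin n → ℝ} (hx : x ∉ U) :
    zeroExt f x = 0 := by
  have h : ∀ y : U, ¬ (y : Fin n → ℝ) = x := fun y hy => hx (hy ▸ y.2)
  simp [zeroExt, Function.extend, h]

theorem zeroExt_add {U : Opens (Fin n → ℝ)} (f g : C(U, ℝ)) (x : Fin n → ℝ) :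
    zeroExt (f + g) x = zeroExt f x + zeroExt g x := by
  by_cases hx : x ∈ U
  · simp [zeroExt_apply _ hx]
  · simp [zeroExt_of_notMem _ hx]

theorem zeroExt_smul {U : Opens (Fin n → ℝ)} (c : ℝ) (f : C(U, ℝ)) (x : Fin n → ℝ) :
    zeroExt (c • f) x = c * zeroExt f x := by
  by_cases hx : x ∈ U
  · simp [zeroExt_apply _ hx]
  · simp [zeroExt_of_notMem _ hx]

theorem continuousOn_zeroExt {U : Opens (Fin n → ℝ)} (f : C(U, ℝ)) :
    ContinuousOn (zeroExt f) (U : Set (Fin n → ℝ)) := by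
  rw [continuousOn_iff_continuous_domRestrict]
  refine f.continuous.congr fun x => ?_
  exact (zeroExt_apply f x.2).symm

/-! ## Functions of class one in the `k`-th variable -/

/-- `U_k(x) = {t | (x₁, …, x_{k-1}, t, x_{k+1}, …, x_n) ∈ U}`. -/
def slice (U : Opens (Fin n → ℝ)) (k : Fin n) (x : Fin n → ℝ) : Set ℝ :=
  {t | Function.update x k t ∈ U}

/-- The function `t ↦ f (x₁, …, x_{k-1}, t, x_{k+1}, …, x_n)`; only its values on the open set
`slice U k x` are meaningful. -/
def sliceFun {U : Opens (Fin n → ℝ)} (f : C(U, ℝ)) (k : Fin n) (x : Fin n → ℝ) : ℝ → ℝ :=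
  fun t => zeroExt f (Function.update x k t)

/-- The classical partial derivative `∂ₖ f` as a function on `U`. -/
def pderiv {U : Opens (Fin n → ℝ)} (k : Fin n) (f : C(U, ℝ)) : U → ℝ :=
  fun x => deriv (sliceFun f k x.1) (x.1 k)

/-- `f` is of class one in the `k`-th variable: all its one-variable functions in the direction `k`
are `C¹` and `∂ₖ f` is continuous on `U`. -/
def IsC1 {U : Opens (Fin n → ℝ)} (k : Fin n) (f : C(U, ℝ)) : Prop :=
  (∀ x ∈ U, ContDiffOn ℝ 1 (sliceFun f k x) (slice U k x)) ∧ Continuous (pderiv k f)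

theorem isOpen_slice (U : Opens (Fin n → ℝ)) (k : Fin n) (x : Fin n → ℝ) :
    IsOpen (slice U k x) :=
  U.isOpen.preimage (continuous_const.update k continuous_id)

theorem mem_slice {U : Opens (Fin n → ℝ)} (k : Fin n) {x : Fin n → ℝ} (hx : x ∈ U) :
    x k ∈ slice U k x := by
  simpa [slice] using hx

theorem IsC1.differentiableAt {U : Opens (Fin n → ℝ)} {k : Fin n} {f : C(U, ℝ)} (hf : IsC1 k f)
    (x : U) : DifferentiableAt ℝ (sliceFun f k x.1) (x.1 k) :=
  ((hf.1 x.1 x.2).contDiffAt ((isOpen_slice U k x.1).mem_nhds (mem_slice k x.2))).differentiableAt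
    one_ne_zero

theorem sliceFun_add {U : Opens (Fin n → ℝ)} (f g : C(U, ℝ)) (k : Fin n) (x : Fin n → ℝ) :
    sliceFun (f + g) k x = sliceFun f k x + sliceFun g k x :=
  funext fun _ => zeroExt_add f g _

theorem sliceFun_smul {U : Opens (Fin n → ℝ)} (c : ℝ) (f : C(U, ℝ)) (k : Fin n)
    (x : Fin n → ℝ) : sliceFun (c • f) k x = c • sliceFun f k x :=
  funext fun _ => zeroExt_smul c f _

theorem sliceFun_zero {U : Opens (Fin n → ℝ)} (k : Fin n) (x : Fin n → ℝ) :
    sliceFun (0 : C(U, ℝ)) k x = 0 := by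
  simpa using sliceFun_smul (0 : ℝ) (0 : C(U, ℝ)) k x

theorem pderiv_add {U : Opens (Fin n → ℝ)} {k : Fin n} {f g : C(U, ℝ)} (hf : IsC1 k f)
    (hg : IsC1 k g) : pderiv k (f + g) = pderiv k f + pderiv k g := by
  funext x
  simp only [pderiv, sliceFun_add, Pi.add_apply]
  exact deriv_add (hf.differentiableAt x) (hg.differentiableAt x)

theorem pderiv_smul {U : Opens (Fin n → ℝ)} {k : Fin n} (c : ℝ) {f : C(U, ℝ)} (hf : IsC1 k f) :
    pderiv k (c • f) = c • pderiv k f := by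
  funext x
  simp only [pderiv, sliceFun_smul, Pi.smul_apply]
  exact deriv_const_smul c (hf.differentiableAt x)

/-- The space `𝒞¹ₖ(U)`. -/
def C1Sub (k : Fin n) (U : Opens (Fin n → ℝ)) : Submodule ℝ C(U, ℝ) where
  carrier := {f | IsC1 k f}
  add_mem' := by
    intro f g hf hg
    refine ⟨fun x hx => ?_, ?_⟩
    · rw [sliceFun_add]
      exact (hf.1 x hx).add (hg.1 x hx)
    · rw [pderiv_add hf hg]
      exact hf.2.add hg.2
  zero_mem' := by
    refine ⟨fun x _ => ?_, ?_⟩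
    · rw [sliceFun_zero]
      exact contDiffOn_const
    · have : pderiv k (0 : C(U, ℝ)) = 0 := by
        funext x
        simp [pderiv, sliceFun_zero]
      rw [this]
      exact continuous_const
  smul_mem' := by
    intro c f hf
    refine ⟨fun x hx => ?_, ?_⟩
    · rw [sliceFun_smul]
      exact (hf.1 x hx).const_smul c
    · rw [pderiv_smul c hf]
      exact hf.2.const_smul c

theorem sliceFun_contRes {U V : Opens (Fin n → ℝ)} (h : V ≤ U) (f : C(U, ℝ)) (k : Fin n)
    (x : Fin n → ℝ) : EqOn (sliceFun (contRes h f) k x) (sliceFun f k x) (slice V k x) := by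
  intro t ht
  simp only [sliceFun]
  rw [zeroExt_apply _ ht, zeroExt_apply _ (h ht)]
  rfl

theorem pderiv_contRes {U V : Opens (Fin n → ℝ)} (h : V ≤ U) (f : C(U, ℝ)) (k : Fin n) (x : V) :
    pderiv k (contRes h f) x = pderiv k f ⟨x.1, h x.2⟩ :=
  Filter.EventuallyEq.deriv_eq ((sliceFun_contRes h f k x.1).eventuallyEq_of_mem
    ((isOpen_slice V k x.1).mem_nhds (mem_slice k x.2)))

theorem IsC1.contRes {U V : Opens (Fin n → ℝ)} (h : V ≤ U) {f : C(U, ℝ)} {k : Fin n}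
    (hf : IsC1 k f) : IsC1 k (contRes h f) := by
  refine ⟨fun x hx => ?_, ?_⟩
  · exact ((hf.1 x (h hx)).mono fun t ht => h ht).congr (sliceFun_contRes h f k x)
  · rw [show pderiv k (UnivDistr.contRes h f) = fun x => pderiv k f ⟨x.1, h x.2⟩ from
      funext fun x => pderiv_contRes h f k x]
    exact hf.2.comp (by fun_prop)

/-- The (pre)sheaf `𝒞¹ₖ`. -/
def C1 (n : ℕ) (k : Fin n) : TopCat.Presheaf (ModuleCat.{0} ℝ) (Rn n) where
  obj U := ModuleCat.of ℝ (C1Sub k (U.unop : Opens (Fin n → ℝ)))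
  map i := ModuleCat.ofHom ((contRes i.unop.le).restrict fun _ hf => hf.contRes i.unop.le)
  map_id _ := rfl
  map_comp _ _ := rfl

/-- The inclusion `ιₖ : 𝒞¹ₖ ↪ 𝒞⁰`. -/
def iotaC1 (k : Fin n) : C1 n k ⟶ C0 n where
  app U := ModuleCat.ofHom (C1Sub k (U.unop : Opens (Fin n → ℝ))).subtype
  naturality _ _ _ := rfl

/-- The partial derivative `∂ₖ : 𝒞¹ₖ(U) → 𝒞⁰(U)` as a linear map. -/
def pderivLin (k : Fin n) (U : Opens (Fin n → ℝ)) : C1Sub k U →ₗ[ℝ] C(U, ℝ) where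
  toFun f := ⟨pderiv k f.1, f.2.2⟩
  map_add' f g := ContinuousMap.ext fun x => congrFun (pderiv_add f.2 g.2) x
  map_smul' c f := ContinuousMap.ext fun x => congrFun (pderiv_smul c f.2) x

/-- The partial derivative `∂ₖ : 𝒞¹ₖ ⟶ 𝒞⁰`. -/
def pderivC1 (k : Fin n) : C1 n k ⟶ C0 n where
  app U := ModuleCat.ofHom (pderivLin k (U.unop : Opens (Fin n → ℝ)))
  naturality U V i := by
    refine ModuleCat.hom_ext (LinearMap.ext fun f => ContinuousMap.ext fun x => ?_)
    exact pderiv_contRes i.unop.le f.1 k x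

/-! ## Schwartz distributions -/

/-- Restriction of distributions from `U` to `V ⊆ U`: `T|_V (φ) = T (φ)`, the test function `φ` on
`V` being seen as a test function on `U`. -/
def distRes (U V : Opens (Fin n → ℝ)) : 𝓓'(U, ℝ) →ₗ[ℝ] 𝓓'(V, ℝ) :=
  ((TestFunction.monoCLM ℝ : 𝓓(V, ℝ) →L[ℝ] 𝓓(U, ℝ)).precompCompactConvergenceCLM ℝ).toLinearMap

theorem distRes_apply (U V : Opens (Fin n → ℝ)) (T : 𝓓'(U, ℝ)) (φ : 𝓓(V, ℝ)) :
    distRes U V T φ = T (TestFunction.monoCLM ℝ φ) := rfl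

/-- The (pre)sheaf `𝒟'` of real valued Schwartz distributions on `ℝⁿ`. -/
def Dist (n : ℕ) : TopCat.Presheaf (ModuleCat.{0} ℝ) (Rn n) where
  obj U := ModuleCat.of ℝ 𝓓'((U.unop : Opens (Fin n → ℝ)), ℝ)
  map {U V} _ := ModuleCat.ofHom (distRes (n := n) U.unop V.unop)
  map_id U := by
    refine ModuleCat.hom_ext (LinearMap.ext fun T => ContinuousLinearMap.ext fun φ => ?_)
    change T (TestFunction.monoCLM ℝ φ) = T φ
    congr 1
    ext x
    simp
  map_comp {U V W} i j := by
    refine ModuleCat.hom_ext (LinearMap.ext fun T => ContinuousLinearMap.ext fun φ => ?_)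
    change T (TestFunction.monoCLM ℝ φ) = T (TestFunction.monoCLM ℝ (TestFunction.monoCLM ℝ φ))
    congr 1
    have hVU : (V.unop : Opens (Fin n → ℝ)) ≤ U.unop := i.unop.le
    have hWV : (W.unop : Opens (Fin n → ℝ)) ≤ V.unop := j.unop.le
    ext x
    simp [hVU, hWV, hWV.trans hVU]

theorem locallyIntegrableOn_zeroExt {U : Opens (Fin n → ℝ)} (f : C(U, ℝ)) :
    LocallyIntegrableOn (zeroExt f) (U : Set (Fin n → ℝ)) volume :=
  (continuousOn_zeroExt f).locallyIntegrableOn U.isOpen.measurableSet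

/-- The distribution `φ ↦ ∫_U φ f` attached to a continuous function `f` on `U`. -/
def regular {U : Opens (Fin n → ℝ)} (f : C(U, ℝ)) : 𝓓'(U, ℝ) :=
  (TestFunction.integralAgainstBilinCLM (ContinuousLinearMap.mul ℝ ℝ) volume (zeroExt f) :
    𝓓(U, ℝ) →L[ℝ] ℝ)

theorem regular_apply {U : Opens (Fin n → ℝ)} (f : C(U, ℝ)) (φ : 𝓓(U, ℝ)) :
    regular f φ = ∫ x, φ x * zeroExt f x :=
  TestFunction.integralAgainstBilinCLM_eq_integral (locallyIntegrableOn_zeroExt f)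

theorem integrable_mul_test {U : Opens (Fin n → ℝ)} (f : C(U, ℝ)) (φ : 𝓓(U, ℝ)) :
    Integrable (fun x => φ x * zeroExt f x) :=
  TestFunction.integrable_bilin (ContinuousLinearMap.mul ℝ ℝ) (locallyIntegrableOn_zeroExt f) φ

theorem regular_contRes {U V : Opens (Fin n → ℝ)} (h : V ≤ U) (f : C(U, ℝ)) :
    regular (contRes h f) = distRes U V (regular f) := by
  ext φ
  rw [distRes_apply, regular_apply, regular_apply]
  congr 1
  funext x
  have hm : (TestFunction.monoCLM ℝ φ : 𝓓(U, ℝ)) x = φ x := by simp [h]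
  rw [hm]
  by_cases hx : x ∈ V
  · rw [zeroExt_apply _ hx, zeroExt_apply _ (h hx)]
    rfl
  · rw [image_eq_zero_of_notMem_tsupport fun h' => hx (φ.tsupport_subset h'), zero_mul, zero_mul]

/-- The embedding `λ_U : 𝒞⁰(U) → 𝒟'(U)`. -/
def lamLin (U : Opens (Fin n → ℝ)) : C(U, ℝ) →ₗ[ℝ] 𝓓'(U, ℝ) where
  toFun := regular
  map_add' f g := by
    refine ContinuousLinearMap.ext fun φ => ?_
    change regular (f + g) φ = regular f φ + regular g φ
    simp only [regular_apply, zeroExt_add, mul_add]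
    exact integral_add (integrable_mul_test f φ) (integrable_mul_test g φ)
  map_smul' c f := by
    refine ContinuousLinearMap.ext fun φ => ?_
    change regular (c • f) φ = c • regular f φ
    simp only [regular_apply, zeroExt_smul, smul_eq_mul, ← integral_const_mul, mul_left_comm]

/-- The embedding `λ : 𝒞⁰ ⟶ 𝒟'`. -/
def lam (n : ℕ) : C0 n ⟶ Dist n where
  app U := ModuleCat.ofHom (lamLin (U.unop : Opens (Fin n → ℝ)))
  naturality _ _ i := ModuleCat.hom_ext (LinearMap.ext fun f => regular_contRes i.unop.le f)

/-- The distributional partial derivative `(Dₖ T)(φ) = - T(∂ₖ φ)`. -/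
def dderivLin (k : Fin n) (U : Opens (Fin n → ℝ)) : 𝓓'(U, ℝ) →ₗ[ℝ] 𝓓'(U, ℝ) :=
  (Distribution.lineDerivCLM (Pi.single k (1 : ℝ)) : 𝓓'(U, ℝ) →L[ℝ] 𝓓'(U, ℝ)).toLinearMap

theorem dderivLin_apply (k : Fin n) (U : Opens (Fin n → ℝ)) (T : 𝓓'(U, ℝ)) (φ : 𝓓(U, ℝ)) :
    dderivLin k U T φ = - T (TestFunction.lineDerivCLM ℝ (Pi.single k (1 : ℝ)) φ) := rfl

theorem dderivLin_distRes (k : Fin n) {U V : Opens (Fin n → ℝ)} (h : V ≤ U) (T : 𝓓'(U, ℝ)) :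
    dderivLin k V (distRes U V T) = distRes U V (dderivLin k U T) := by
  ext φ
  rw [dderivLin_apply, distRes_apply, distRes_apply, dderivLin_apply]
  congr 2
  ext x
  simp [h]

/-- The distributional partial derivative `Dₖ : 𝒟' ⟶ 𝒟'`. -/
def dderiv (k : Fin n) : Dist n ⟶ Dist n where
  app U := ModuleCat.ofHom (dderivLin k (U.unop : Opens (Fin n → ℝ)))
  naturality _ _ i := ModuleCat.hom_ext (LinearMap.ext fun T => dderivLin_distRes k i.unop.le T)

/-! ## The problem -/

/-- `U` is an `n`-dimensional interval `(c₁ - r, c₁ + r) × ⋯ × (cₙ - r, cₙ + r)`, `r > 0`. -/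
def IsInterval (U : Opens (Fin n → ℝ)) : Prop :=
  ∃ (c : Fin n → ℝ) (r : ℝ), 0 < r ∧
    (U : Set (Fin n → ℝ)) = Set.univ.pi fun k => Ioo (c k - r) (c k + r)

/-- `c` does not depend on the variable `x_k`. -/
def IndepOfVar {U : Opens (Fin n → ℝ)} (k : Fin n) (c : C(U, ℝ)) : Prop :=
  ∀ x y : U, (∀ l, l ≠ k → x.1 l = y.1 l) → c x = c y

/-- `θ` is a polynomial in `x_k` of degree `< d` (zero for `d = 0`) whose coefficients are
continuous functions on `U` independent of `x_k`. -/
def IsPolyInVar {U : Opens (Fin n → ℝ)} (k : Fin n) (d : ℕ) (θ : C(U, ℝ)) : Prop :=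
  ∃ c : Fin d → C(U, ℝ), (∀ i, IndepOfVar k (c i)) ∧
    ∀ x : U, θ x = ∑ i : Fin d, c i x * x.1 k ^ (i : ℕ)

/-- The inclusion of real vector spaces of the lowest universe into those of the universe `u`. It
only serves to let `H` below take values in an arbitrary universe. -/
abbrev lift : ModuleCat.{0} ℝ ⥤ ModuleCat.{u} ℝ := ModuleCat.uliftFunctor.{u, 0} ℝ

/-- The data `(H, j, (δₖ)ₖ)`. A sheaf morphism is a natural transformation; the sheaf
condition on `H` is part of `Triple.IsSolution`. -/
structure Triple (n : ℕ) where
  H : TopCat.Presheaf (ModuleCat.{u} ℝ) (Rn n)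
  j : C0 n ⋙ lift.{u} ⟶ H
  δ : Fin n → (H ⟶ H)

namespace Triple

/-- Arrows between triples are arbitrary morphisms of the underlying (pre)sheaves. -/
instance : Category (Triple.{u} n) where
  Hom A B := A.H ⟶ B.H
  id A := 𝟙 A.H
  comp {A B D} f g := CategoryStruct.comp (X := A.H) (Y := B.H) (Z := D.H) f g

/-- The morphism of (pre)sheaves underlying an arrow of triples. -/
def toNat {A B : Triple.{u} n} (ψ : A ⟶ B) : A.H ⟶ B.H := ψ

/-- `δ^α = δ₁^{α₁} ∘ ⋯ ∘ δₙ^{αₙ}`; in `End`, multiplication is composition of functions. -/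
def δpow (S : Triple.{u} n) (α : Fin n → ℕ) : S.H ⟶ S.H :=
  (List.ofFn fun k => (End.of (S.δ k)) ^ α k).prod

/-- The value `j_U(f) ∈ H(U)`. -/
def emb (S : Triple.{u} n) (U : Opens (Fin n → ℝ)) (f : C(U, ℝ)) : S.H.obj (op U) :=
  (S.j.app (op U)).hom (ULift.up f)

/-- The problem `𝒫(H, j, (δₖ)ₖ)`. -/
structure IsSolution (S : Triple.{u} n) : Prop where
  isSheaf : S.H.IsSheaf
  compat : ∀ k : Fin n, Functor.whiskerRight (iotaC1 k) lift.{u} ≫ S.j ≫ S.δ k =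
    Functor.whiskerRight (pderivC1 k) lift.{u} ≫ S.j
  poly : ∀ (α : Fin n → ℕ) (U : Opens (Fin n → ℝ)), IsInterval U →
    ∀ (f : C(U, ℝ)) (θ : Fin n → C(U, ℝ)), f = ∑ k, θ k → (∀ k, IsPolyInVar k (α k) (θ k)) →
      ((S.δpow α).app (op U)).hom (S.emb U f) = 0
  comm : ∀ h k : Fin n, S.δ h ≫ S.δ k = S.δ k ≫ S.δ h

/-- The property `𝒬`: `ψ` preserves the embeddings and the derivatives. -/
def Preserves ⦃A B : Triple.{u} n⦄ (ψ : A ⟶ B) : Prop :=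
  A.j ≫ toNat ψ = B.j ∧ ∀ k : Fin n, A.δ k ≫ toNat ψ = toNat ψ ≫ B.δ k

end Triple

/-- The triple `(𝒟', λ, (Dₖ)ₖ)`. -/
def distTriple (n : ℕ) : Triple.{u} n where
  H := Dist n ⋙ lift.{u}
  j := Functor.whiskerRight (lam n) lift.{u}
  δ k := Functor.whiskerRight (dderiv k) lift.{u}

end UnivDistr

end

noncomputable section

namespace UnivDistr

variable {n : ℕ}

/-! ## Multi-index powers -/

/-! A morphism with property 𝒬 has no freedom: locally every distribution is `D^α λ(f)` with `f`
continuous, so `ψ` must send it to `δ^α j(f)`. The issue is whether this prescription is consistent.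
Its graph is the relation `LocRep`. Two representations `D^α f` and `D^β g` on the same interval can
be brought to the common order `α + β`, because continuous functions on intervals have continuous
iterated primitives, and conditions 3 and 5 force these to have the same derivatives in every
solution. If both represent the same distribution, the difference `h` of the two new functions
satisfies `D^(α+β) λ(h) = 0`. On an interval this forces `h = θ₁ + ⋯ + θₙ` as in condition 4, so `h`
is also killed in `H`. The local values in `H` therefore agree on overlaps and glue.

This argument is `Triple.existsUnique_preserves`. Apart from the verification of the elementary
conditions, it leaves three facts about distributions.

Local structure (`exists_eq_multiPow_lamLin`): near a point, continuity bounds `T φ` by the sup norm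
of a single derivative `∂^(m,…,m) φ`. By Hahn–Banach, `T φ = L(∂^(m,…,m) φ)` for a continuous
functional `L` on `C(K)`. Since `∏ₖ (yₖ - zₖ)₊` is a fundamental solution of `∂₁² ⋯ ∂ₙ²`, applying
`L` to it in the variable `y` gives a continuous function of `z` of which `T` is, up to sign, a
derivative.

Kernel (`exists_eq_sum_isPolyInVar`): subtract successively from `f` its Lagrange interpolants in
`x₁, …, xₙ`. Each subtracted term is an admissible `θₖ`. The remainder vanishes for smooth `f` with
`∂^α f = 0`, and then for continuous `f` by mollification, because at each point it depends on only
finitely many values of `f`.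

Sheaf condition (`distTriple_isSheaf`): partitions of unity. -/

/-- `d^α = d₁^{α₁} ⋯ dₙ^{αₙ}` in a monoid. -/
def multiPow {M : Type*} [Monoid M] (d : Fin n → M) (α : Fin n → ℕ) : M :=
  (List.ofFn fun k => d k ^ α k).prod

section MultiPow

variable {M N : Type*} [Monoid M] [Monoid N]

theorem multiPow_succ (d : Fin (n + 1) → M) (α : Fin (n + 1) → ℕ) :
    multiPow d α = d 0 ^ α 0 * multiPow (fun k => d k.succ) (fun k => α k.succ) := by
  simp [multiPow, List.ofFn_succ]

theorem multiPow_zero (d : Fin n → M) : multiPow d 0 = 1 := by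
  induction n with
  | zero => simp [multiPow]
  | succ n ih =>
    rw [multiPow_succ]
    have : (fun k : Fin n => (0 : Fin (n + 1) → ℕ) k.succ) = 0 := rfl
    rw [this, ih]
    simp

theorem map_multiPow (F : M →* N) (d : Fin n → M) (α : Fin n → ℕ) :
    F (multiPow d α) = multiPow (fun k => F (d k)) α := by
  induction n with
  | zero => simp [multiPow]
  | succ n ih => simp [multiPow_succ, ih]

theorem commute_multiPow {a : M} {d : Fin n → M} (h : ∀ k, Commute a (d k)) (α : Fin n → ℕ) :
    Commute a (multiPow d α) := by
  induction n with
  | zero => simp [multiPow]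
  | succ n ih =>
    rw [multiPow_succ]
    exact ((h 0).pow_right _).mul_right (ih (fun k => h k.succ) _)

/-- Pairwise commutation is what lets `d 0 ^ β 0` move past the remaining factors of `α`; for the
solutions of the problem this is condition 5. -/
theorem multiPow_add {d : Fin n → M} (h : ∀ k l, Commute (d k) (d l)) (α β : Fin n → ℕ) :
    multiPow d (α + β) = multiPow d α * multiPow d β := by
  induction n with
  | zero => simp [multiPow]
  | succ n ih =>
    have h1 := ih (d := fun k => d k.succ) (fun k l => h _ _) (fun k => α k.succ)
      (fun k => β k.succ)
    have h2 : Commute (d 0 ^ β 0) (multiPow (fun k => d k.succ) fun k => α k.succ) :=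
      (commute_multiPow (fun k => h _ _) _).pow_left _
    simp only [multiPow_succ, Pi.add_apply, pow_add]
    change _ * multiPow _ ((fun k => α k.succ) + fun k => β k.succ) = _
    rw [h1, mul_assoc, ← mul_assoc (d 0 ^ β 0), h2.eq]
    simp only [mul_assoc]

theorem multiPow_single (d : Fin n → M) (k : Fin n) (m : ℕ) :
    multiPow d (Pi.single k m) = d k ^ m := by
  induction n with
  | zero => exact k.elim0
  | succ n ih =>
    rw [multiPow_succ]
    refine Fin.cases ?_ (fun k => ?_) k
    · have : (fun l : Fin n => (Pi.single 0 m : Fin (n + 1) → ℕ) l.succ) = 0 := by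
        funext l
        simp
      rw [this, multiPow_zero]
      simp
    · have : (fun l : Fin n => (Pi.single k.succ m : Fin (n + 1) → ℕ) l.succ) = Pi.single k m := by
        funext l
        simp [Pi.single_apply]
      rw [this, ih]
      simp [(Fin.succ_ne_zero k).symm]

/-- Induction over multi-indices, adding one unit vector at a time. -/
theorem multiIndex_induction {P : (Fin n → ℕ) → Prop} (zero : P 0)
    (add_single : ∀ α k, P α → P (α + Pi.single k 1)) (α : Fin n → ℕ) : P α := by
  induction h : ∑ k, α k generalizing α with
  | zero =>
    have : α = 0 := funext fun k => by simpa using (Finset.sum_eq_zero_iff.1 h) k (Finset.mem_univ k)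
    exact this ▸ zero
  | succ m ih =>
    obtain ⟨k, hk⟩ : ∃ k, α k ≠ 0 := by
      by_contra! hα
      simp [hα] at h
    have hle : Pi.single k 1 ≤ α := by
      intro l
      rcases eq_or_ne l k with rfl | hl
      · simpa using Nat.one_le_iff_ne_zero.2 hk
      · simp [hl]
    have hα : α - Pi.single k 1 + Pi.single k 1 = α := tsub_add_cancel_of_le hle
    rw [← hα]
    refine add_single _ _ (ih _ ?_)
    have : ∑ l, (α - Pi.single k 1 + Pi.single k 1 : Fin n → ℕ) l = m + 1 := by rw [hα, h]
    simp only [Pi.add_apply, Finset.sum_add_distrib, Finset.sum_pi_single', Finset.mem_univ,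
      if_true] at this
    omega

end MultiPow

/-- The common mechanism behind restriction, convolution, reflection, slicing and universe lifting:
each is linear and needs checking against one partial derivative only. -/
theorem multiPow_intertwine {R E F : Type*} [Semiring R] [AddCommMonoid E] [Module R E]
    [AddCommMonoid F] [Module R F] (A : E →ₗ[R] F) {d : Fin n → Module.End R E}
    {d' : Fin n → Module.End R F} (h : ∀ k x, A (d k x) = d' k (A x)) (α : Fin n → ℕ) (x : E) :
    A (multiPow d α x) = multiPow d' α (A x) := by
  induction n with
  | zero => simp [multiPow]
  | succ n ih =>
    have hp : ∀ (m : ℕ) (y : E), A ((d 0 ^ m) y) = (d' 0 ^ m) (A y) := by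
      intro m
      induction m with
      | zero => simp
      | succ m ihm =>
        intro y
        simp only [pow_succ, Module.End.mul_apply, ihm, h]
    simp only [multiPow_succ, Module.End.mul_apply, hp, ih (fun k => h k.succ)]

/-! ## Sections of triples -/

namespace Triple

variable (S : Triple.{u} n)

/-- The linear restriction map `H(U) → H(V)` for `V ≤ U`. -/
def res {U V : Opens (Fin n → ℝ)} (h : V ≤ U) : S.H.obj (op U) →ₗ[ℝ] S.H.obj (op V) :=
  (S.H.map (homOfLE (X := Opens (Rn n)) h).op).hom

/-- `δₖ` on the sections over `U`. -/
def sec (U : Opens (Fin n → ℝ)) (k : Fin n) : Module.End ℝ (S.H.obj (op U)) :=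
  ((S.δ k).app (op U)).hom

/-- Evaluation of endomorphisms of `H` on the sections over `U`. -/
def endApp (U : Opens (Fin n → ℝ)) : End S.H →* Module.End ℝ (S.H.obj (op U)) where
  toFun φ := (NatTrans.app φ (op U)).hom
  map_one' := rfl
  map_mul' _ _ := rfl

theorem δpow_app (α : Fin n → ℕ) (U : Opens (Fin n → ℝ)) :
    ((S.δpow α).app (op U)).hom = multiPow (S.sec U) α :=
  map_multiPow (S.endApp U) (fun k => End.of (S.δ k)) α

theorem emb_add {U : Opens (Fin n → ℝ)} (f g : C(U, ℝ)) :
    S.emb U (f + g) = S.emb U f + S.emb U g :=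
  map_add (S.j.app (op U)).hom (ULift.up f) (ULift.up g)

theorem emb_smul {U : Opens (Fin n → ℝ)} (c : ℝ) (f : C(U, ℝ)) :
    S.emb U (c • f) = c • S.emb U f :=
  map_smul (S.j.app (op U)).hom c (ULift.up f)

theorem res_res {U V W : Opens (Fin n → ℝ)} (h : V ≤ U) (h' : W ≤ V) (s : S.H.obj (op U)) :
    S.res h' (S.res h s) = S.res (h'.trans h) s := by
  change (S.H.map _ ≫ S.H.map _).hom s = _
  rw [← S.H.map_comp]
  rfl

theorem res_self {U : Opens (Fin n → ℝ)} (s : S.H.obj (op U)) : S.res le_rfl s = s := by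
  change (S.H.map (𝟙 _)).hom s = s
  rw [S.H.map_id]
  rfl

theorem res_emb {U V : Opens (Fin n → ℝ)} (h : V ≤ U) (f : C(U, ℝ)) :
    S.res h (S.emb U f) = S.emb V (contRes h f) :=
  (LinearMap.congr_fun (congrArg ModuleCat.Hom.hom
    (S.j.naturality (homOfLE (X := Opens (Rn n)) h).op)) (ULift.up f)).symm

theorem res_sec {U V : Opens (Fin n → ℝ)} (h : V ≤ U) (k : Fin n) (s : S.H.obj (op U)) :
    S.res h (S.sec U k s) = S.sec V k (S.res h s) :=
  (LinearMap.congr_fun (congrArg ModuleCat.Hom.hom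
    ((S.δ k).naturality (homOfLE (X := Opens (Rn n)) h).op)) s).symm

theorem res_multiPow {U V : Opens (Fin n → ℝ)} (h : V ≤ U) (α : Fin n → ℕ) (s : S.H.obj (op U)) :
    S.res h (multiPow (S.sec U) α s) = multiPow (S.sec V) α (S.res h s) :=
  multiPow_intertwine _ (S.res_sec h) _ _

variable {S}

theorem IsSolution.commute (hS : S.IsSolution) (U : Opens (Fin n → ℝ)) (k l : Fin n) :
    Commute (S.sec U k) (S.sec U l) :=
  congrArg (S.endApp U) (hS.comm l k)

theorem IsSolution.sec_emb (hS : S.IsSolution) {U : Opens (Fin n → ℝ)} (k : Fin n)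
    (F : C1Sub k U) : S.sec U k (S.emb U F.1) = S.emb U (pderivLin k U F) :=
  LinearMap.congr_fun (congrArg ModuleCat.Hom.hom
    (congrArg (fun φ => NatTrans.app φ (op U)) (hS.compat k))) (ULift.up F)

theorem IsSolution.multiPow_emb_eq_zero (hS : S.IsSolution) {U : Opens (Fin n → ℝ)}
    (hU : IsInterval U) {α : Fin n → ℕ} {θ : Fin n → C(U, ℝ)}
    (hθ : ∀ k, IsPolyInVar k (α k) (θ k)) : multiPow (S.sec U) α (S.emb U (∑ k, θ k)) = 0 := by
  rw [← δpow_app]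
  exact hS.poly α U hU _ θ rfl hθ

theorem IsSolution.exists_gluing (hS : S.IsSolution) {ι : Type} {U : Opens (Fin n → ℝ)}
    {V : ι → Opens (Fin n → ℝ)} (hV : ∀ i, V i ≤ U) (hU : ∀ x ∈ U, ∃ i, x ∈ V i)
    (s : ∀ i, S.H.obj (op (V i)))
    (hs : ∀ i j, S.res (inf_le_left : V i ⊓ V j ≤ V i) (s i) =
      S.res (inf_le_right : V i ⊓ V j ≤ V j) (s j)) :
    ∃ t : S.H.obj (op U), ∀ i, S.res (hV i) t = s i := by
  obtain ⟨t, ht, -⟩ := TopCat.Sheaf.existsUnique_gluing' (X := Rn n) ⟨S.H, hS.isSheaf⟩ V U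
    (fun i => homOfLE (hV i)) (fun x hx => by simpa using hU x hx) s hs
  exact ⟨t, ht⟩

theorem IsSolution.eq_of_locally_eq (hS : S.IsSolution) {U : Opens (Fin n → ℝ)}
    {s t : S.H.obj (op U)}
    (h : ∀ x ∈ U, ∃ (V : Opens (Fin n → ℝ)) (hV : V ≤ U), x ∈ V ∧ S.res hV s = S.res hV t) :
    s = t := by
  choose V hV hx hst using h
  exact TopCat.Sheaf.eq_of_locally_eq' (X := Rn n) ⟨S.H, hS.isSheaf⟩
    (fun x : U => V x.1 x.2) U (fun x => homOfLE (hV x.1 x.2))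
    (fun x hx' => Opens.mem_iSup.2 ⟨⟨x, hx'⟩, hx x hx'⟩) s t fun x => hst x.1 x.2

end Triple

/-! ### Intervals as open balls of the sup norm -/

/-- The interval with center `c` and radius `r`. -/
def cube (c : Fin n → ℝ) (r : ℝ) : Opens (Fin n → ℝ) := ⟨Metric.ball c r, Metric.isOpen_ball⟩

theorem mem_cube {c x : Fin n → ℝ} {r : ℝ} (hr : 0 < r) :
    x ∈ cube c r ↔ ∀ k, |x k - c k| < r := by
  change x ∈ Metric.ball c r ↔ _
  simp [dist_pi_lt_iff hr, Real.dist_eq]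

theorem coe_cube (c : Fin n → ℝ) {r : ℝ} (hr : 0 < r) :
    (cube c r : Set (Fin n → ℝ)) = Set.univ.pi fun k => Ioo (c k - r) (c k + r) := by
  ext x
  rw [SetLike.mem_coe, mem_cube hr]
  simp only [mem_univ_pi, mem_Ioo, abs_sub_lt_iff]
  exact forall_congr' fun k => ⟨fun h => ⟨by linarith, by linarith⟩,
    fun h => ⟨by linarith [h.2], by linarith [h.1]⟩⟩

theorem isInterval_cube (c : Fin n → ℝ) {r : ℝ} (hr : 0 < r) : IsInterval (cube c r) :=
  ⟨c, r, hr, coe_cube c hr⟩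

theorem IsInterval.exists_eq_cube {U : Opens (Fin n → ℝ)} (hU : IsInterval U) :
    ∃ (c : Fin n → ℝ) (r : ℝ), 0 < r ∧ U = cube c r := by
  obtain ⟨c, r, hr, h⟩ := hU
  exact ⟨c, r, hr, SetLike.coe_injective (h.trans (coe_cube c hr).symm)⟩

theorem exists_cube_le {U : Opens (Fin n → ℝ)} {x : Fin n → ℝ} (hx : x ∈ U) :
    ∃ r, 0 < r ∧ cube x r ≤ U :=
  Metric.isOpen_iff.1 U.isOpen x hx

theorem mem_cube_self (x : Fin n → ℝ) {r : ℝ} (hr : 0 < r) : x ∈ cube x r :=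
  Metric.mem_ball_self hr

/-! ## Primitives on intervals -/

theorem sliceFun_update {U : Opens (Fin n → ℝ)} (f : C(U, ℝ)) (k : Fin n) (x : Fin n → ℝ) (t : ℝ) :
    sliceFun f k (Function.update x k t) = sliceFun f k x := by
  funext s
  simp [sliceFun]

theorem sliceFun_self {U : Opens (Fin n → ℝ)} (f : C(U, ℝ)) (k : Fin n) (x : U) :
    sliceFun f k x.1 (x.1 k) = f x := by
  simp [sliceFun, zeroExt_apply f x.2]

theorem continuousOn_sliceFun {U : Opens (Fin n → ℝ)} (f : C(U, ℝ)) (k : Fin n) (x : Fin n → ℝ) :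
    ContinuousOn (sliceFun f k x) (slice U k x) :=
  (continuousOn_zeroExt f).comp (f := fun t : ℝ => Function.update x k t)
    (show Continuous fun t : ℝ => Function.update x k t from
      continuous_const.update k continuous_id).continuousOn fun _ ht => ht

/-- Moving `x` in the direction `k` does not change the slice through it, so derivatives known at
base points only already give the derivative along the whole slice; continuity of `g` then gives
class `C¹`. -/
theorem isC1_of_hasDerivAt {U : Opens (Fin n → ℝ)} {k : Fin n} {f g : C(U, ℝ)}
    (h : ∀ x : U, HasDerivAt (sliceFun f k x.1) (g x) (x.1 k)) : IsC1 k f ∧ pderiv k f = g := by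
  have hd : pderiv k f = g := funext fun x => (h x).deriv
  refine ⟨⟨fun x hx => ?_, hd ▸ g.continuous⟩, hd⟩
  have h' : ∀ t ∈ slice U k x, HasDerivAt (sliceFun f k x) (sliceFun g k x t) t := by
    intro t ht
    have := h ⟨_, ht⟩
    rw [sliceFun_update] at this
    simpa [sliceFun, zeroExt_apply g ht] using this
  rw [show (1 : WithTop ℕ∞) = 0 + 1 from rfl,
    contDiffOn_succ_iff_deriv_of_isOpen (isOpen_slice U k x)]
  refine ⟨fun t ht => (h' t ht).differentiableAt.differentiableWithinAt, by simp, ?_⟩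
  rw [contDiffOn_zero]
  exact (continuousOn_sliceFun g k x).congr fun t ht => (h' t ht).deriv

/-- The primitive is `F(x) = ∫ f` along the `k`-th direction from the center `c k` to `x k`; an
interval contains the segment in question. -/
theorem exists_primitive {U : Opens (Fin n → ℝ)} (hU : IsInterval U) (k : Fin n) (f : C(U, ℝ)) :
    ∃ F : C1Sub k U, pderivLin k U F = f := by
  obtain ⟨c, r, hr, rfl⟩ := hU.exists_eq_cube
  let ρ : cube c r → ℝ := fun x => |x.1 k - c k|
  -- `τ` clamps `t` to within distance `|x k - c k|` of the center, so that the integrand is defined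
  -- and jointly continuous for all real `t`, as continuity of the parametric integral requires. On
  -- the range of integration the clamp does nothing (`hseg`).
  let τ : cube c r → ℝ → ℝ := fun x t => max (c k - ρ x) (min (c k + ρ x) t)
  have hk : Continuous fun x : cube c r => x.1 k :=
    (continuous_apply k).comp continuous_subtype_val
  have hρ : Continuous ρ := (hk.sub continuous_const).abs
  have hρ0 : ∀ x, 0 ≤ ρ x := fun x => abs_nonneg _
  have hmem : ∀ x t, Function.update x.1 k (τ x t) ∈ cube c r := by
    intro x t
    rw [mem_cube hr]
    intro l
    rcases eq_or_ne l k with rfl | hl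
    · rw [Function.update_self]
      refine lt_of_le_of_lt ?_ ((mem_cube hr).1 x.2 l)
      change |_| ≤ ρ x
      have := hρ0 x
      rw [abs_le]
      constructor
      · have := le_max_left (c l - ρ x) (min (c l + ρ x) t)
        linarith
      · have : max (c l - ρ x) (min (c l + ρ x) t) ≤ c l + ρ x :=
          max_le (by linarith) (min_le_left _ _)
        linarith
    · rw [Function.update_of_ne hl]
      exact (mem_cube hr).1 x.2 l
  let h : cube c r → ℝ → ℝ := fun x t => f ⟨_, hmem x t⟩
  have hh : Continuous (Function.uncurry h) := by
    refine f.continuous.comp (Continuous.subtype_mk ?_ _)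
    exact (continuous_subtype_val.comp continuous_fst).update k (by fun_prop)
  let F : C(cube c r, ℝ) := ⟨fun x => ∫ t in (c k)..(x.1 k), h x t,
    intervalIntegral.continuous_parametric_intervalIntegral_of_continuous hh hk⟩
  have hseg : ∀ x : cube c r, ∀ t ∈ uIcc (c k) (x.1 k), τ x t = t := by
    intro x t ht
    have hx : t ∈ Icc (c k - ρ x) (c k + ρ x) := by
      have h1 := abs_sub_left_of_mem_uIcc ht
      have h2 : |t - c k| ≤ ρ x := h1
      rw [abs_le] at h2
      exact ⟨by linarith, by linarith⟩
    simp only [τ]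
    rw [min_eq_right hx.2, max_eq_right hx.1]
  have hF : ∀ x, F x = ∫ t in (c k)..(x.1 k), sliceFun f k x.1 t := by
    intro x
    refine intervalIntegral.integral_congr fun t ht => ?_
    have : Function.update x.1 k t ∈ cube c r := by
      rw [← hseg x t ht]
      exact hmem x t
    simp only [sliceFun]
    rw [zeroExt_apply f this]
    congr 3
    exact hseg x t ht
  have key := isC1_of_hasDerivAt (k := k) (f := F) (g := f) fun x => by
    have hx := mem_slice k x.2
    have hsub : uIcc (c k) (x.1 k) ⊆ slice (cube c r) k x.1 := by
      intro t ht
      change _ ∈ cube c r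
      rw [← hseg x t ht]
      exact hmem x t
    have hopen := isOpen_slice (cube c r) k x.1
    have hcont := continuousOn_sliceFun f k x.1
    have := intervalIntegral.integral_hasDerivAt_right (a := c k) (b := x.1 k)
      (hcont.mono hsub).intervalIntegrable
      (hcont.stronglyMeasurableAtFilter hopen _ hx) (hcont.continuousAt (hopen.mem_nhds hx))
    rw [sliceFun_self] at this
    refine this.congr_of_eventuallyEq ?_
    filter_upwards [hopen.mem_nhds hx] with t ht
    change zeroExt F _ = _
    rw [zeroExt_apply F ht, hF]
    simp only [sliceFun_update, Function.update_self]
  exact ⟨⟨F, key.1⟩, ContinuousMap.ext fun x => congrFun key.2 x⟩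

/-- On an interval every continuous function is a `β`-th derivative, simultaneously for all
solutions. -/
theorem exists_multi_primitive {U : Opens (Fin n → ℝ)} (hU : IsInterval U) (β : Fin n → ℕ)
    (f : C(U, ℝ)) : ∃ F : C(U, ℝ), ∀ S : Triple.{u} n, S.IsSolution →
      multiPow (S.sec U) β (S.emb U F) = S.emb U f := by
  induction β using multiIndex_induction generalizing f with
  | zero => exact ⟨f, fun S _ => by rw [multiPow_zero]; rfl⟩
  | add_single β k ih =>
    obtain ⟨G, hG⟩ := ih f
    obtain ⟨F, hF⟩ := exists_primitive hU k G
    refine ⟨F.1, fun S hS => ?_⟩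
    rw [multiPow_add (hS.commute U), multiPow_single, pow_one, Module.End.mul_apply,
      hS.sec_emb, hF, hG S hS]

/-! ## A criterion for co-universality -/

namespace Triple

variable {A B : Triple.{u} n}

/-- Locally on intervals, `a` and `b` are the derivatives of the same order of the same continuous
function. -/
def LocRep (A B : Triple.{u} n) {U : Opens (Fin n → ℝ)} (a : A.H.obj (op U))
    (b : B.H.obj (op U)) : Prop :=
  ∀ x ∈ U, ∃ (V : Opens (Fin n → ℝ)) (h : V ≤ U), IsInterval V ∧ x ∈ V ∧
    ∃ (α : Fin n → ℕ) (f : C(V, ℝ)), A.res h a = multiPow (A.sec V) α (A.emb V f) ∧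
      B.res h b = multiPow (B.sec V) α (B.emb V f)

section LocRep

variable {U : Opens (Fin n → ℝ)} {a a' : A.H.obj (op U)} {b b' : B.H.obj (op U)}

/-- Representations restrict to smaller intervals; allowing every radius `s ≤ r` lets two of them be
placed on one common cube. -/
theorem LocRep.of_le (h : LocRep A B a b) {x : Fin n → ℝ} (hx : x ∈ U)
    {W : Opens (Fin n → ℝ)} (hW : x ∈ W) :
    ∃ r, 0 < r ∧ ∀ s, 0 < s → s ≤ r → ∃ (hU : cube x s ≤ U), cube x s ≤ W ∧
      ∃ (α : Fin n → ℕ) (f : C(cube x s, ℝ)),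
        A.res hU a = multiPow (A.sec _) α (A.emb _ f) ∧
        B.res hU b = multiPow (B.sec _) α (B.emb _ f) := by
  obtain ⟨V, hV, -, hxV, α, f, ha, hb⟩ := h x hx
  obtain ⟨r, hr, hrV⟩ := exists_cube_le (U := V ⊓ W) ⟨hxV, hW⟩
  refine ⟨r, hr, fun s hs hsr => ?_⟩
  have hle : cube x s ≤ V ⊓ W := le_trans (fun y hy => Metric.ball_subset_ball hsr hy) hrV
  have hle' : cube x s ≤ V := hle.trans inf_le_left
  refine ⟨hle'.trans hV, hle.trans inf_le_right, α, contRes hle' f, ?_, ?_⟩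
  · rw [← A.res_res hV hle', ha, res_multiPow, res_emb]
  · rw [← B.res_res hV hle', hb, res_multiPow, res_emb]

theorem LocRep.res (h : LocRep A B a b) {V : Opens (Fin n → ℝ)} (hV : V ≤ U) :
    LocRep A B (A.res hV a) (B.res hV b) := by
  intro x hx
  obtain ⟨r, hr, H⟩ := h.of_le (hV hx) hx
  obtain ⟨hU, hW, α, f, ha, hb⟩ := H r hr le_rfl
  exact ⟨_, hW, isInterval_cube x hr, mem_cube_self x hr, α, f, by rw [res_res, ha],
    by rw [res_res, hb]⟩

/-- Replace `f` by an `α'`-th primitive and `f'` by an `α`-th primitive; both terms then have order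
`α + α'`. The primitives do not depend on the triple, so one and the same function serves in `A` and
in `B`. -/
theorem LocRep.add (hA : A.IsSolution) (hB : B.IsSolution) (h : LocRep A B a b)
    (h' : LocRep A B a' b') : LocRep A B (a + a') (b + b') := by
  intro x hx
  obtain ⟨r, hr, H⟩ := h.of_le hx hx
  obtain ⟨r', hr', H'⟩ := h'.of_le hx hx
  have hs : 0 < min r r' := lt_min hr hr'
  obtain ⟨hU, -, α, f, ha, hb⟩ := H _ hs (min_le_left _ _)
  obtain ⟨_, -, α', f', ha', hb'⟩ := H' _ hs (min_le_right _ _)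
  have hI := isInterval_cube x hs
  obtain ⟨F, hF⟩ := exists_multi_primitive.{u} hI α' f
  obtain ⟨F', hF'⟩ := exists_multi_primitive.{u} hI α f'
  have key : ∀ S : Triple.{u} n, S.IsSolution → multiPow (S.sec _) (α + α') (S.emb _ (F + F')) =
      multiPow (S.sec _) α (S.emb _ f) + multiPow (S.sec _) α' (S.emb _ f') := by
    intro S hS
    rw [emb_add, map_add]
    congr 1
    · rw [multiPow_add (hS.commute _), Module.End.mul_apply, hF S hS]
    · rw [add_comm, multiPow_add (hS.commute _), Module.End.mul_apply, hF' S hS]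
  exact ⟨_, hU, hI, mem_cube_self x hs, α + α', F + F', by rw [map_add, ha, ha', key A hA],
    by rw [map_add, hb, hb', key B hB]⟩

theorem LocRep.smul (c : ℝ) (h : LocRep A B a b) : LocRep A B (c • a) (c • b) := by
  intro x hx
  obtain ⟨V, hV, hI, hxV, α, f, ha, hb⟩ := h x hx
  exact ⟨V, hV, hI, hxV, α, c • f, by rw [map_smul, ha, emb_smul, map_smul],
    by rw [map_smul, hb, emb_smul, map_smul]⟩

theorem LocRep.sec (hA : A.IsSolution) (hB : B.IsSolution) (k : Fin n) (h : LocRep A B a b) :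
    LocRep A B (A.sec U k a) (B.sec U k b) := by
  intro x hx
  obtain ⟨V, hV, hI, hxV, α, f, ha, hb⟩ := h x hx
  have key : ∀ S : Triple.{u} n, S.IsSolution → multiPow (S.sec V) (Pi.single k 1 + α) (S.emb V f) =
      S.sec V k (multiPow (S.sec V) α (S.emb V f)) := by
    intro S hS
    rw [multiPow_add (hS.commute _), multiPow_single, pow_one, Module.End.mul_apply]
  exact ⟨V, hV, hI, hxV, _, f, by rw [res_sec, ha, key A hA], by rw [res_sec, hb, key B hB]⟩

end LocRep

theorem locRep_emb {U : Opens (Fin n → ℝ)} (f : C(U, ℝ)) :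
    LocRep A B (A.emb U f) (B.emb U f) := by
  intro x hx
  obtain ⟨r, hr, hle⟩ := exists_cube_le hx
  exact ⟨_, hle, isInterval_cube x hr, mem_cube_self x hr, 0, contRes hle f,
    by rw [res_emb, multiPow_zero]; rfl, by rw [res_emb, multiPow_zero]; rfl⟩

/-- Every section of `H` is locally a derivative of a continuous function. -/
def LocallyDeriv (A : Triple.{u} n) : Prop :=
  ∀ (U : Opens (Fin n → ℝ)) (a : A.H.obj (op U)), ∀ x ∈ U,
    ∃ (V : Opens (Fin n → ℝ)) (h : V ≤ U), IsInterval V ∧ x ∈ V ∧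
      ∃ (α : Fin n → ℕ) (f : C(V, ℝ)), A.res h a = multiPow (A.sec V) α (A.emb V f)

/-- On intervals, only the sums `θ₁ + ⋯ + θₙ` have vanishing `α`-th derivative. -/
def MinimalKernel (A : Triple.{u} n) : Prop :=
  ∀ (V : Opens (Fin n → ℝ)), IsInterval V → ∀ (α : Fin n → ℕ) (f : C(V, ℝ)),
    multiPow (A.sec V) α (A.emb V f) = 0 →
      ∃ θ : Fin n → C(V, ℝ), f = ∑ k, θ k ∧ ∀ k, IsPolyInVar k (α k) (θ k)

/-- Here condition 4 enters: a function whose derivative vanishes in `A` is a sum of the polynomial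
type, and such sums are killed in every solution. -/
theorem LocRep.eq_zero (hA : A.MinimalKernel) (hB : B.IsSolution)
    {U : Opens (Fin n → ℝ)} {b : B.H.obj (op U)} (h : LocRep A B 0 b) : b = 0 := by
  refine hB.eq_of_locally_eq fun x hx => ?_
  obtain ⟨V, hV, hI, hxV, α, f, ha, hb⟩ := h x hx
  rw [map_zero] at ha
  obtain ⟨θ, rfl, hθ⟩ := hA V hI α f ha.symm
  exact ⟨V, hV, hxV, by rw [hb, map_zero, hB.multiPow_emb_eq_zero hI hθ]⟩

theorem LocRep.unique (hA : A.IsSolution) (hK : A.MinimalKernel) (hB : B.IsSolution)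
    {U : Opens (Fin n → ℝ)} {a : A.H.obj (op U)} {b b' : B.H.obj (op U)} (h : LocRep A B a b)
    (h' : LocRep A B a b') : b = b' := by
  have := h.add hA hB (h'.smul (-1))
  rw [neg_one_smul, neg_one_smul, add_neg_cancel, ← sub_eq_add_neg] at this
  exact sub_eq_zero.1 (this.eq_zero hK hB)

/-- Copy to `B` the local representations of `a`. On overlaps the copies represent the same section
of `A`, so `LocRep.unique` makes them a compatible family. -/
theorem LocallyDeriv.exists_locRep (hA : A.IsSolution) (hL : A.LocallyDeriv)
    (hK : A.MinimalKernel) (hB : B.IsSolution) {U : Opens (Fin n → ℝ)} (a : A.H.obj (op U)) :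
    ∃ b : B.H.obj (op U), LocRep A B a b := by
  choose V hV hI hx α f ha using fun x : U => hL U a x.1 x.2
  have hloc : ∀ x : U, LocRep A B (A.res (hV x) a) (multiPow (B.sec (V x)) (α x) (B.emb _ (f x))) :=
    fun x y hy => ⟨V x, le_rfl, hI x, hy, α x, f x, by rw [res_self, ha], by rw [res_self]⟩
  obtain ⟨b, hb⟩ := hB.exists_gluing hV (fun x hx' => ⟨⟨x, hx'⟩, hx ⟨x, hx'⟩⟩)
    (fun x => multiPow (B.sec (V x)) (α x) (B.emb _ (f x))) fun x y => by
      have h1 := (hloc x).res (inf_le_left : V x ⊓ V y ≤ V x)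
      have h2 := (hloc y).res (inf_le_right : V x ⊓ V y ≤ V y)
      rw [res_res] at h1 h2
      exact h1.unique hA hK hB h2
  exact ⟨b, fun x hx' => ⟨V ⟨x, hx'⟩, hV _, hI _, hx _, α _, f _, ha _, hb _⟩⟩

/-- `LocRep` is the graph of the morphism: its stability under sums, scalars, restrictions and `δₖ`
gives all the required properties. -/
theorem existsUnique_preserves (hA : A.IsSolution) (hL : A.LocallyDeriv) (hK : A.MinimalKernel)
    (hB : B.IsSolution) : ∃! ψ : A ⟶ B, Preserves ψ := by
  choose ψ hψ using fun U (a : A.H.obj (op U)) => hL.exists_locRep hA hK hB a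
  have huniq : ∀ {U} {a : A.H.obj (op U)} {b : B.H.obj (op U)}, LocRep A B a b → ψ U a = b :=
    fun h => (hψ _ _).unique hA hK hB h
  let Ψ : A.H ⟶ B.H :=
    { app := fun U => ModuleCat.ofHom
        { toFun := ψ U.unop
          map_add' := fun a a' => huniq ((hψ _ a).add hA hB (hψ _ a'))
          map_smul' := fun c a => huniq ((hψ _ a).smul c) }
      naturality := fun U V i => by
        refine ModuleCat.hom_ext (LinearMap.ext fun a => ?_)
        exact huniq ((hψ _ a).res i.unop.le) }
  refine ⟨Ψ, ⟨?_, fun k => ?_⟩, fun Φ hΦ => ?_⟩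
  · refine NatTrans.ext (funext fun U => ModuleCat.hom_ext (LinearMap.ext fun f => ?_))
    exact huniq (locRep_emb (U := U.unop) f.down)
  · refine NatTrans.ext (funext fun U => ModuleCat.hom_ext (LinearMap.ext fun a => ?_))
    exact huniq ((hψ U.unop a).sec hA hB k)
  · refine NatTrans.ext (funext fun U => ModuleCat.hom_ext (LinearMap.ext fun a => ?_))
    -- Any competitor `Φ` carries a local representation of `a` to the same representation in `B`,
    -- so `Φ a` is related to `a` by `LocRep`.
    refine (huniq (U := U.unop) ?_).symm
    let Φ' : ∀ V : Opens (Fin n → ℝ), A.H.obj (op V) →ₗ[ℝ] B.H.obj (op V) :=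
      fun V => ((toNat Φ).app (op V)).hom
    have hres : ∀ {V W : Opens (Fin n → ℝ)} (h : W ≤ V) (s : A.H.obj (op V)),
        Φ' W (A.res h s) = B.res h (Φ' V s) := fun h s =>
      LinearMap.congr_fun (congrArg ModuleCat.Hom.hom
        ((toNat Φ).naturality (homOfLE (X := Opens (Rn n)) h).op)) s
    have hemb : ∀ (V : Opens (Fin n → ℝ)) (f : C(V, ℝ)), Φ' V (A.emb V f) = B.emb V f :=
      fun V f => LinearMap.congr_fun (congrArg ModuleCat.Hom.hom
        (congrArg (fun φ => NatTrans.app φ (op V)) hΦ.1)) (ULift.up f)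
    have hsec : ∀ (V : Opens (Fin n → ℝ)) (k : Fin n) (s : A.H.obj (op V)),
        Φ' V (A.sec V k s) = B.sec V k (Φ' V s) :=
      fun V k s => LinearMap.congr_fun (congrArg ModuleCat.Hom.hom
        (congrArg (fun φ => NatTrans.app φ (op V)) (hΦ.2 k))) s
    intro x hx
    obtain ⟨V, hV, hI, hxV, α, f, ha⟩ := hL U.unop a x hx
    refine ⟨V, hV, hI, hxV, α, f, ha, ?_⟩
    change B.res hV (Φ' _ a) = _
    rw [← hres, ha, multiPow_intertwine _ (hsec V), hemb]

end Triple

/-! ## Smooth functions and test functions -/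

/-- The space of smooth functions on `ℝⁿ`. -/
def Smooth (n : ℕ) : Submodule ℝ ((Fin n → ℝ) → ℝ) where
  carrier := {f | ContDiff ℝ (⊤ : ℕ∞) f}
  add_mem' {f g} (hf : ContDiff ℝ (⊤ : ℕ∞) f) (hg : ContDiff ℝ (⊤ : ℕ∞) g) := hf.add hg
  zero_mem' := show ContDiff ℝ (⊤ : ℕ∞) fun _ : Fin n → ℝ => (0 : ℝ) from contDiff_const
  smul_mem' c f (hf : ContDiff ℝ (⊤ : ℕ∞) f) := hf.const_smul c

theorem Smooth.contDiff (f : Smooth n) : ContDiff ℝ (⊤ : ℕ∞) f.1 := f.2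

theorem Smooth.differentiable (f : Smooth n) : Differentiable ℝ f.1 :=
  (Smooth.contDiff f).differentiable (by simp)

theorem contDiff_fderiv_apply {f : (Fin n → ℝ) → ℝ} (hf : ContDiff ℝ (⊤ : ℕ∞) f) (v : Fin n → ℝ) :
    ContDiff ℝ (⊤ : ℕ∞) fun x => fderiv ℝ f x v :=
  (hf.fderiv_right (m := (⊤ : ℕ∞)) (by simp)).clm_apply contDiff_const

/-- The partial derivative of smooth functions. -/
def Smooth.pd (k : Fin n) : Module.End ℝ (Smooth n) where
  toFun f := ⟨fun x => fderiv ℝ f.1 x (Pi.single k 1), contDiff_fderiv_apply f.2 _⟩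
  map_add' f g := Subtype.ext <| funext fun x => by
    change fderiv ℝ (f.1 + g.1) x _ = _
    rw [fderiv_add (Smooth.differentiable f x) (Smooth.differentiable g x)]
    rfl
  map_smul' c f := Subtype.ext <| funext fun x => by
    change fderiv ℝ (c • f.1) x _ = _
    rw [fderiv_const_smul (Smooth.differentiable f x)]
    rfl

theorem Smooth.pd_apply (k : Fin n) (f : Smooth n) (x : Fin n → ℝ) :
    (Smooth.pd k f).1 x = fderiv ℝ f.1 x (Pi.single k 1) := rfl

theorem fderiv_fderiv_comm {f : (Fin n → ℝ) → ℝ} (hf : ContDiff ℝ (⊤ : ℕ∞) f)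
    (v w x : Fin n → ℝ) :
    fderiv ℝ (fun y => fderiv ℝ f y v) x w = fderiv ℝ (fun y => fderiv ℝ f y w) x v := by
  have hd : DifferentiableAt ℝ (fderiv ℝ f) x :=
    (hf.fderiv_right (m := (⊤ : ℕ∞)) (by simp)).differentiable (by simp) x
  have key : ∀ v w : Fin n → ℝ,
      fderiv ℝ (fun y => fderiv ℝ f y v) x w = fderiv ℝ (fderiv ℝ f) x w v := by
    intro v w
    rw [fderiv_clm_apply hd (differentiableAt_const v)]
    simp
  rw [key, key]
  exact (hf.contDiffAt.isSymmSndFDerivAt (by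
    rw [minSmoothness_of_isRCLikeNormedField]
    exact WithTop.coe_le_coe.2 (le_top (a := (2 : ℕ∞))))) w v

theorem Smooth.commute_pd (k l : Fin n) : Commute (Smooth.pd (n := n) k) (Smooth.pd l) :=
  LinearMap.ext fun f => Subtype.ext <| funext fun x => fderiv_fderiv_comm f.2 _ _ x

section TestFunctions

variable {U : Opens (Fin n → ℝ)}

/-- The partial derivative of test functions. -/
def tderiv (U : Opens (Fin n → ℝ)) (k : Fin n) : Module.End ℝ 𝓓(U, ℝ) :=
  (TestFunction.lineDerivCLM ℝ (Pi.single k (1 : ℝ)) : 𝓓(U, ℝ) →L[ℝ] 𝓓(U, ℝ)).toLinearMap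

/-- A test function as a smooth function. -/
def testToSmooth (U : Opens (Fin n → ℝ)) : 𝓓(U, ℝ) →ₗ[ℝ] Smooth n where
  toFun φ := ⟨φ, φ.contDiff⟩
  map_add' _ _ := rfl
  map_smul' _ _ := rfl

theorem tderiv_apply (k : Fin n) (φ : 𝓓(U, ℝ)) (x : Fin n → ℝ) :
    tderiv U k φ x = fderiv ℝ φ x (Pi.single k 1) := by
  change (TestFunction.lineDerivCLM ℝ _ φ : 𝓓(U, ℝ)) x = _
  rw [TestFunction.lineDerivCLM_eq_fderivCLM, TestFunction.fderivCLM_apply]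
  simp

theorem testToSmooth_tderiv (k : Fin n) (φ : 𝓓(U, ℝ)) :
    testToSmooth U (tderiv U k φ) = Smooth.pd k (testToSmooth U φ) :=
  Subtype.ext <| funext fun x => tderiv_apply k φ x

theorem testToSmooth_injective : Function.Injective (testToSmooth (n := n) U) := fun _ _ h =>
  TestFunction.ext fun x => congrFun (congrArg Subtype.val h) x

theorem commute_tderiv (k l : Fin n) : Commute (tderiv U k) (tderiv U l) :=
  LinearMap.ext fun φ => testToSmooth_injective <| by
    change testToSmooth U (tderiv U k (tderiv U l φ)) = testToSmooth U (tderiv U l (tderiv U k φ))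
    simp only [testToSmooth_tderiv]
    exact LinearMap.congr_fun (Smooth.commute_pd k l) _

/-! ## Derivatives of distributions -/

theorem dderivLin_apply_tderiv (k : Fin n) (T : 𝓓'(U, ℝ)) (φ : 𝓓(U, ℝ)) :
    dderivLin k U T φ = - T (tderiv U k φ) := rfl

theorem commute_dderivLin (k l : Fin n) : Commute (dderivLin k U) (dderivLin l U) :=
  LinearMap.ext fun T => ContinuousLinearMap.ext fun φ => by
    change dderivLin k U (dderivLin l U T) φ = dderivLin l U (dderivLin k U T) φ
    simp only [dderivLin_apply_tderiv, neg_neg]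
    exact congrArg T (LinearMap.congr_fun (commute_tderiv l k) φ)

/-- Each transposition of a derivative contributes one sign. The order in which derivatives reach
the test function is reversed, which is harmless as they commute. -/
theorem multiPow_dderivLin_apply (α : Fin n → ℕ) (T : 𝓓'(U, ℝ)) (φ : 𝓓(U, ℝ)) :
    multiPow (fun k => dderivLin k U) α T φ = (-1) ^ (∑ k, α k) * T (multiPow (tderiv U) α φ) := by
  induction α using multiIndex_induction generalizing T with
  | zero => simp [multiPow_zero]
  | add_single α k ih =>
    rw [multiPow_add commute_dderivLin, multiPow_single, add_comm, multiPow_add commute_tderiv,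
      multiPow_single, pow_one, pow_one, Module.End.mul_apply, Module.End.mul_apply, ih,
      dderivLin_apply_tderiv]
    simp [Finset.sum_add_distrib, pow_add]

theorem hasLineDerivAt_zeroExt {k : Fin n} (F : C1Sub k U) (x : U) :
    HasLineDerivAt ℝ (zeroExt F.1) (pderiv k F.1 x) x.1 (Pi.single k 1) := by
  have h : HasDerivAt (sliceFun F.1 k x.1) (pderiv k F.1 x) (x.1 k + 0) := by
    rw [add_zero]
    exact (F.2.differentiableAt x).hasDerivAt
  have := h.comp_const_add (x.1 k) 0
  refine this.congr_of_eventuallyEq (Filter.Eventually.of_forall fun t => ?_)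
  simp only [sliceFun]
  congr 1
  funext l
  rcases eq_or_ne l k with rfl | hl
  · simp
  · simp [hl]

/-- Integration by parts in the single direction `k`, applied to the compactly supported product `φ
F`; only line derivatives are available, as `F` need not be differentiable in the other directions.
-/
theorem dderivLin_lamLin (k : Fin n) (F : C1Sub k U) :
    dderivLin k U (lamLin U F.1) = lamLin U (pderivLin k U F) := by
  refine ContinuousLinearMap.ext fun φ => ?_
  change - regular F.1 (tderiv U k φ) = regular (pderivLin k U F) φ
  have i1 := integrable_mul_test F.1 (tderiv U k φ)
  have i2 := integrable_mul_test (pderivLin k U F) φ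
  -- With first factor the constant `1`, the formula says that the integral of the line derivative
  -- of `φ F` is zero.
  have key := integral_bilinear_hasLineDerivAt_right_eq_neg_left_of_integrable
    (μ := (volume : Measure (Fin n → ℝ))) (B := ContinuousLinearMap.mul ℝ ℝ)
    (f := fun _ => 1) (f' := fun _ => 0) (v := Pi.single k 1)
    (g := fun x => φ x * zeroExt F.1 x)
    (g' := fun x => tderiv U k φ x * zeroExt F.1 x + φ x * zeroExt (pderivLin k U F) x)
    (by simp) (by
      simp only [ContinuousLinearMap.mul_apply', one_mul]
      exact i1.add i2) (by simpa using integrable_mul_test F.1 φ)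
    (fun x _ => by simpa using (hasFDerivAt_const (𝕜 := ℝ) (1 : ℝ) x).hasLineDerivAt (Pi.single k (1 : ℝ)))
    (fun x _ => by
      by_cases hx : x ∈ U
      · have h1 : HasLineDerivAt ℝ φ (tderiv U k φ x) x (Pi.single k 1) := by
          rw [tderiv_apply]
          exact ((φ.contDiff.differentiable (by simp)) x).hasFDerivAt.hasLineDerivAt _
        have h2 := hasLineDerivAt_zeroExt F ⟨x, hx⟩
        have := HasDerivAt.mul h1 h2
        simp only [zero_smul, add_zero] at this
        rw [zeroExt_apply (pderivLin k U F) hx]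
        exact this
      -- Outside `U` the zero extension of `F` may be discontinuous, but `φ`, hence the product,
      -- vanishes in a neighbourhood of `x`.
      · have hφ : φ =ᶠ[nhds x] 0 :=
          notMem_tsupport_iff_eventuallyEq.1 fun h => hx (φ.tsupport_subset h)
        have h0 : fderiv ℝ φ x = 0 := by
          rw [hφ.fderiv_eq]
          simp
        rw [tderiv_apply, h0, hφ.self_of_nhds]
        have : (fun x => φ x * zeroExt F.1 x) =ᶠ[nhds x] fun _ => 0 := by
          filter_upwards [hφ] with y hy
          simp [hy]
        have h2 := ((hasFDerivAt_const (𝕜 := ℝ) (0 : ℝ) x).congr_of_eventuallyEq this).hasLineDerivAt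
          (Pi.single k (1 : ℝ))
        simpa using h2)
  simp only [ContinuousLinearMap.mul_apply', one_mul, zero_mul, integral_zero, neg_zero] at key
  rw [integral_add i1 i2] at key
  rw [regular_apply, regular_apply]
  exact neg_eq_of_add_eq_zero_right key

/-! ## Functions polynomial in one variable -/

theorem IsPolyInVar.exists_deriv {k : Fin n} {m : ℕ} {θ : C(U, ℝ)} (hθ : IsPolyInVar k (m + 1) θ) :
    ∃ h : IsC1 k θ, IsPolyInVar k m (pderivLin k U ⟨θ, h⟩) := by
  obtain ⟨c, hc, hcθ⟩ := hθ
  have hk : Continuous fun x : U => x.1 k := (continuous_apply k).comp continuous_subtype_val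
  let c' : Fin m → C(U, ℝ) := fun i => ((i : ℝ) + 1) • c i.succ
  let θ' : C(U, ℝ) := ∑ i : Fin m, c' i * ⟨fun x : U => x.1 k, hk⟩ ^ (i : ℕ)
  have hθ' : ∀ x, θ' x = ∑ i : Fin m, c' i x * x.1 k ^ (i : ℕ) := fun x => by simp [θ']
  have key := isC1_of_hasDerivAt (k := k) (f := θ) (g := θ') fun x => by
    have h1 : HasDerivAt (fun t : ℝ => ∑ i : Fin (m + 1), c i x * t ^ (i : ℕ)) (θ' x) (x.1 k) := by
      have := HasDerivAt.fun_sum (u := Finset.univ) fun (i : Fin (m + 1)) _ =>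
        (hasDerivAt_pow (i : ℕ) (x.1 k)).const_mul (c i x)
      refine this.congr_deriv ?_
      rw [Fin.sum_univ_succ, hθ']
      simp only [c', Fin.val_zero, Fin.val_succ]
      simp only [ContinuousMap.smul_apply, smul_eq_mul]
      push_cast
      simp only [zero_mul, mul_zero, zero_add]
      exact Finset.sum_congr rfl fun i _ => by ring
    refine h1.congr_of_eventuallyEq ?_
    filter_upwards [(isOpen_slice U k x.1).mem_nhds (mem_slice k x.2)] with t ht
    simp only [sliceFun]
    rw [zeroExt_apply θ ht, hcθ]
    refine Finset.sum_congr rfl fun i _ => ?_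
    rw [hc i ⟨_, ht⟩ x fun l hl => by simp [hl]]
    simp
  refine ⟨key.1, c', fun i x y hxy => ?_, fun x => ?_⟩
  · simp only [c', ContinuousMap.smul_apply, hc i.succ x y hxy]
  · rw [← hθ']
    exact congrFun key.2 x

theorem IsPolyInVar.dderivLin_pow_eq_zero {k : Fin n} {m : ℕ} {θ : C(U, ℝ)}
    (hθ : IsPolyInVar k m θ) : (dderivLin k U ^ m) (lamLin U θ) = 0 := by
  induction m generalizing θ with
  | zero =>
    obtain ⟨c, -, hc⟩ := hθ
    have : θ = 0 := ContinuousMap.ext fun x => by simp [hc]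
    simp [this]
  | succ m ih =>
    obtain ⟨h, hp⟩ := hθ.exists_deriv
    rw [pow_succ, Module.End.mul_apply, dderivLin_lamLin k ⟨θ, h⟩, ih hp]

/-- In the `k`-th summand, the factor `D_k^(α k)` can be applied first, and it already kills `θ k`.
-/
theorem multiPow_dderivLin_eq_zero {α : Fin n → ℕ} {θ : Fin n → C(U, ℝ)}
    (hθ : ∀ k, IsPolyInVar k (α k) (θ k)) :
    multiPow (fun k => dderivLin k U) α (lamLin U (∑ k, θ k)) = 0 := by
  rw [map_sum, map_sum]
  refine Finset.sum_eq_zero fun k _ => ?_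
  have hle : Pi.single k (α k) ≤ α := by
    intro l
    rcases eq_or_ne l k with rfl | hl
    · simp
    · simp [hl]
  rw [← tsub_add_cancel_of_le hle, multiPow_add commute_dderivLin, multiPow_single,
    Module.End.mul_apply, (hθ k).dderivLin_pow_eq_zero, map_zero]

end TestFunctions

/-! ## The triple of distributions -/

section DistTriple

variable (U : Opens (Fin n → ℝ))

theorem distTriple_multiPow (α : Fin n → ℕ) (T : 𝓓'(U, ℝ)) :
    multiPow ((distTriple.{u} n).sec U) α (ULift.up T : (distTriple.{u} n).H.obj (op U)) =
      ULift.up (multiPow (fun k => dderivLin k U) α T) :=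
  (multiPow_intertwine (ULift.moduleEquiv (R := ℝ) (M := 𝓓'(U, ℝ))).symm.toLinearMap
    (fun _ _ => rfl) α T).symm

theorem distTriple_isSolution (h : (distTriple.{u} n).H.IsSheaf) :
    (distTriple.{u} n).IsSolution where
  isSheaf := h
  compat k := by
    refine NatTrans.ext (funext fun U => ModuleCat.hom_ext (LinearMap.ext fun F => ?_))
    exact congrArg ULift.up (dderivLin_lamLin (U := U.unop) k F.down)
  poly := by
    rintro α U - f θ rfl hθ
    rw [Triple.δpow_app]
    exact (distTriple_multiPow U α _).trans (congrArg ULift.up (multiPow_dderivLin_eq_zero hθ))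
  comm k l := by
    refine NatTrans.ext (funext fun U => ModuleCat.hom_ext (LinearMap.ext fun T => ?_))
    exact congrArg ULift.up (LinearMap.congr_fun (commute_dderivLin (U := U.unop) l k) T.down)

end DistTriple

/-! ## Interpolation in one variable -/

theorem exists_derivative_eq {p : Polynomial ℝ} {m : ℕ} (hp : p.degree < m) :
    ∃ P : Polynomial ℝ, P.derivative = p ∧ P.degree < (m + 1 : ℕ) := by
  refine ⟨∑ i ∈ Finset.range m, Polynomial.monomial (i + 1) (p.coeff i / (i + 1)), ?_, ?_⟩
  · ext j
    rw [Polynomial.coeff_derivative, Polynomial.finsetSum_coeff]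
    simp only [Polynomial.coeff_monomial, add_left_inj, Finset.sum_ite_eq', Finset.mem_range]
    split_ifs with h
    · field_simp
    · rw [zero_mul, Polynomial.coeff_eq_zero_of_degree_lt]
      exact hp.trans_le (Nat.cast_le.2 (not_lt.1 h))
  · rw [← Polynomial.mem_degreeLT]
    refine Submodule.sum_mem _ fun i hi => Polynomial.mem_degreeLT.2 ?_
    refine (Polynomial.degree_monomial_le _ _).trans_lt (Nat.cast_lt.2 ?_)
    have := Finset.mem_range.1 hi
    omega

/-- The Lagrange interpolation of `g` in the variable `x_k` at the nodes `t k 0, …, t k (α k - 1)`. -/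
def interp (t : Fin n → ℕ → ℝ) (α : Fin n → ℕ) (k : Fin n) (g : (Fin n → ℝ) → ℝ) :
    (Fin n → ℝ) → ℝ := fun x => ∑ i ∈ Finset.range (α k),
  g (Function.update x k (t k i)) * (Lagrange.basis (Finset.range (α k)) (t k) i).eval (x k)

/-- The successive interpolation errors of `g` in the variables of the list `l`. -/
def interpErr (t : Fin n → ℕ → ℝ) (α : Fin n → ℕ) (l : List (Fin n)) (g : (Fin n → ℝ) → ℝ) :
    (Fin n → ℝ) → ℝ :=
  l.foldl (fun h k => h - interp t α k h) g

section Interp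

variable {t : Fin n → ℕ → ℝ} {α : Fin n → ℕ} {c : Fin n → ℝ} {s : ℝ}

theorem update_mem_cube (hs : 0 < s) (k : Fin n) {τ : ℝ} (hτ : |τ - c k| < s) {x : Fin n → ℝ}
    (hx : x ∈ cube c s) : Function.update x k τ ∈ cube c s := by
  rw [mem_cube hs] at hx ⊢
  intro l
  rcases eq_or_ne l k with rfl | hl
  · simpa using hτ
  · simpa [hl] using hx l

theorem continuous_updateAt (k : Fin n) (τ : ℝ) :
    Continuous fun x : Fin n → ℝ => Function.update x k τ :=
  continuous_id.update k continuous_const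

/-- Expanding the Lagrange basis in powers of `x k`, the coefficients are combinations of the values
of `g` at `x k = t k i`, hence free of `x k`. The nodes lie in the interval, so these values are
continuous. -/
theorem exists_isPolyInVar_interp (hs : 0 < s) (ht : ∀ k i, |t k i - c k| < s)
    (hinj : ∀ k, Function.Injective (t k)) (k : Fin n) {g : (Fin n → ℝ) → ℝ}
    (hg : ContinuousOn g (cube c s)) :
    ∃ θ : C(cube c s, ℝ), IsPolyInVar k (α k) θ ∧ ∀ x, θ x = interp t α k g x.1 := by
  have hcont : ∀ i, Continuous fun x : cube c s => g (Function.update x.1 k (t k i)) := fun i =>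
    hg.comp_continuous ((continuous_updateAt k _).comp continuous_subtype_val)
      fun x => update_mem_cube hs k (ht k i) x.2
  have hk : Continuous fun x : cube c s => x.1 k := (continuous_apply k).comp continuous_subtype_val
  refine ⟨⟨fun x => interp t α k g x.1, ?_⟩, ⟨fun j => ⟨fun x => ∑ i ∈ Finset.range (α k),
    g (Function.update x.1 k (t k i)) *
      (Lagrange.basis (Finset.range (α k)) (t k) i).coeff j, ?_⟩, ?_, ?_⟩, fun _ => rfl⟩
  · exact continuous_finsetSum _ fun i _ => (hcont i).mul ((Polynomial.continuous _).comp hk)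
  · exact continuous_finsetSum _ fun i _ => (hcont i).mul continuous_const
  · intro j x y hxy
    simp only [ContinuousMap.coe_mk]
    refine Finset.sum_congr rfl fun i _ => ?_
    congr 2
    funext l
    rcases eq_or_ne l k with rfl | hl
    · simp
    · simp [hl, hxy l hl]
  · intro x
    simp only [interp, ContinuousMap.coe_mk, Finset.sum_mul]
    rw [Finset.sum_comm]
    refine Finset.sum_congr rfl fun i hi => ?_
    rw [Polynomial.eval_eq_sum_range' (n := α k), Finset.mul_sum,
      ← Fin.sum_univ_eq_sum_range
        (fun j => g (Function.update x.1 k (t k i)) * ((Lagrange.basis _ _ i).coeff j * x.1 k ^ j))]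
    · exact Finset.sum_congr rfl fun j _ => (mul_assoc _ _ _).symm
    · rw [Lagrange.natDegree_basis (hinj k).injOn hi, Finset.card_range]
      have := Finset.mem_range.1 hi
      omega

theorem continuousOn_interp (hs : 0 < s) (ht : ∀ k i, |t k i - c k| < s) (k : Fin n)
    {g : (Fin n → ℝ) → ℝ} (hg : ContinuousOn g (cube c s)) :
    ContinuousOn (interp t α k g) (cube c s) := by
  refine continuousOn_finsetSum _ fun i _ => ContinuousOn.mul ?_
    ((Polynomial.continuous _).comp (continuous_apply k)).continuousOn
  exact hg.comp (continuous_updateAt k _).continuousOn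
    fun x hx => update_mem_cube hs k (ht k i) hx

theorem IsPolyInVar.add {U : Opens (Fin n → ℝ)} {k : Fin n} {d : ℕ} {θ θ' : C(U, ℝ)}
    (h : IsPolyInVar k d θ) (h' : IsPolyInVar k d θ') : IsPolyInVar k d (θ + θ') := by
  obtain ⟨c, hc, hθ⟩ := h
  obtain ⟨c', hc', hθ'⟩ := h'
  refine ⟨fun i => c i + c' i, fun i x y hxy => ?_, fun x => ?_⟩
  · simp [hc i x y hxy, hc' i x y hxy]
  · simp [hθ, hθ', add_mul, Finset.sum_add_distrib]

theorem isPolyInVar_zero {U : Opens (Fin n → ℝ)} (k : Fin n) (d : ℕ) :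
    IsPolyInVar k d (0 : C(U, ℝ)) :=
  ⟨0, fun _ _ _ _ => rfl, fun x => by simp⟩

/-- A telescoping sum: each passage to the next error subtracts one interpolant, which is added to
the corresponding `θ k`. -/
theorem exists_eq_interpErr_add (hs : 0 < s) (ht : ∀ k i, |t k i - c k| < s)
    (hinj : ∀ k, Function.Injective (t k)) (l : List (Fin n)) {g : (Fin n → ℝ) → ℝ}
    (hg : ContinuousOn g (cube c s)) :
    ∃ θ : Fin n → C(cube c s, ℝ), (∀ k, IsPolyInVar k (α k) (θ k)) ∧
      ∀ x : cube c s, g x = interpErr t α l g x + ∑ k, θ k x := by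
  induction l generalizing g with
  | nil => exact ⟨0, fun k => isPolyInVar_zero k _, fun x => by simp [interpErr]⟩
  | cons k l ih =>
    obtain ⟨θ, hθ, h⟩ := ih (hg.sub (continuousOn_interp (α := α) hs ht k hg))
    obtain ⟨θ', hθ', h'⟩ := exists_isPolyInVar_interp (α := α) hs ht hinj k hg
    refine ⟨θ + Pi.single k θ', fun j => ?_, fun x => ?_⟩
    · rcases eq_or_ne j k with rfl | hj
      · simpa using (hθ j).add hθ'
      · simpa [hj] using hθ j
    · have h1 := h x
      have h2 : ∑ j, (Pi.single k θ' : Fin n → C(cube c s, ℝ)) j x = θ' x := by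
        rw [Finset.sum_eq_single k]
        · simp
        · intro j _ hj
          simp [hj]
        · simp
      simp only [Pi.sub_apply] at h1
      simp only [Pi.add_apply, ContinuousMap.add_apply, Finset.sum_add_distrib, h2, h']
      change g x = interpErr t α l (g - interp t α k g) x + _
      change g x - _ = interpErr t α l (g - interp t α k g) x + _ at h1
      linarith

/-- At a given point the error is a fixed linear combination of finitely many values of the
function, so pointwise convergence suffices. -/
theorem tendsto_interpErr (hs : 0 < s) (ht : ∀ k i, |t k i - c k| < s) (l : List (Fin n))
    {u : ℕ → (Fin n → ℝ) → ℝ} {g : (Fin n → ℝ) → ℝ}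
    (h : ∀ x ∈ cube c s, Filter.Tendsto (fun j => u j x) Filter.atTop (nhds (g x)))
    {x : Fin n → ℝ} (hx : x ∈ cube c s) :
    Filter.Tendsto (fun j => interpErr t α l (u j) x) Filter.atTop (nhds (interpErr t α l g x)) := by
  induction l generalizing u g with
  | nil => exact h x hx
  | cons k l ih =>
    refine ih fun y hy => (h y hy).sub ?_
    exact tendsto_finsetSum _ fun i _ =>
      (h _ (update_mem_cube hs k (ht k i) hy)).mul tendsto_const_nhds

theorem contDiff_updateAt (k : Fin n) (τ : ℝ) :
    ContDiff ℝ (⊤ : ℕ∞) fun x : Fin n → ℝ => Function.update x k τ := by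
  rw [contDiff_pi]
  intro l
  rcases eq_or_ne l k with rfl | hl
  · simpa using contDiff_const
  · simpa [hl] using contDiff_apply ℝ ℝ l

theorem contDiff_interp (t : Fin n → ℕ → ℝ) (α : Fin n → ℕ) (k : Fin n) {g : (Fin n → ℝ) → ℝ}
    (hg : ContDiff ℝ (⊤ : ℕ∞) g) : ContDiff ℝ (⊤ : ℕ∞) (interp t α k g) :=
  ContDiff.sum fun _ _ => (hg.comp (contDiff_updateAt k _)).mul
    ((Polynomial.contDiff_aeval _ _).comp (contDiff_apply ℝ ℝ k))

/-- The interpolation error in the variable `x_k` for smooth functions. -/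
def smoothErr (t : Fin n → ℕ → ℝ) (α : Fin n → ℕ) (k : Fin n) : Module.End ℝ (Smooth n) where
  toFun g := ⟨g.1 - interp t α k g.1, (Smooth.contDiff g).sub (contDiff_interp t α k g.2)⟩
  map_add' f g := Subtype.ext <| funext fun x => by
    simp only [interp, Submodule.coe_add, Pi.sub_apply, Pi.add_apply, add_mul,
      Finset.sum_add_distrib]
    ring
  map_smul' r f := Subtype.ext <| funext fun x => by
    simp only [interp, Submodule.coe_smul, Pi.sub_apply, Pi.smul_apply, smul_eq_mul, mul_sub,
      Finset.mul_sum, mul_assoc, RingHom.id_apply]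

theorem Smooth.hasLineDerivAt (g : Smooth n) (k : Fin n) (x : Fin n → ℝ) :
    HasLineDerivAt ℝ g.1 ((Smooth.pd k g).1 x) x (Pi.single k 1) :=
  (Smooth.differentiable g x).hasFDerivAt.hasLineDerivAt _

/-- Interpolation in `x k` freezes `x k` at nodes and multiplies by functions of `x k` alone;
neither affects differentiation in another variable. -/
theorem commute_smoothErr {k l : Fin n} (hkl : k ≠ l) :
    Commute (smoothErr t α k) (Smooth.pd l) := by
  refine LinearMap.ext fun g => Subtype.ext <| funext fun x => ?_
  change _ = (Smooth.pd l (smoothErr t α k g)).1 x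
  have h1 := Smooth.hasLineDerivAt (smoothErr t α k g) l x
  refine HasLineDerivAt.unique ?_ h1
  refine HasDerivAt.sub (Smooth.hasLineDerivAt g l x) ?_
  refine HasDerivAt.fun_sum fun i _ => ?_
  have h2 := Smooth.hasLineDerivAt g l (Function.update x k (t k i))
  have h3 := HasDerivAt.mul_const h2
    ((Lagrange.basis (Finset.range (α k)) (t k) i).eval (x k))
  refine h3.congr_of_eventuallyEq (Filter.Eventually.of_forall fun r => ?_)
  have e1 : (x + r • (Pi.single l 1 : Fin n → ℝ)) k = x k := by simp [hkl]
  have e2 : Function.update (x + r • (Pi.single l 1 : Fin n → ℝ)) k (t k i) =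
      Function.update x k (t k i) + r • (Pi.single l 1 : Fin n → ℝ) := by
    funext j
    rcases eq_or_ne j k with rfl | hj
    · simp [hkl]
    · simp [hj]
  simp only [e1, e2]

theorem hasDerivAt_update (g : Smooth n) (k : Fin n) (x : Fin n → ℝ) (τ : ℝ) :
    HasDerivAt (fun r => g.1 (Function.update x k r)) ((Smooth.pd k g).1 (Function.update x k τ))
      τ := by
  have h := Smooth.hasLineDerivAt g k (Function.update x k τ)
  have h1 : HasDerivAt (fun r => g.1 (Function.update x k τ + r • (Pi.single k 1 : Fin n → ℝ)))
      ((Smooth.pd k g).1 (Function.update x k τ)) (τ - τ) := by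
    rw [sub_self]
    exact h
  refine (h1.comp_sub_const τ τ).congr_of_eventuallyEq (Filter.Eventually.of_forall fun r => ?_)
  refine congrArg g.1 (funext fun j => ?_)
  rcases eq_or_ne j k with rfl | hj
  · simp
  · simp [hj]

theorem exists_poly_of_pd_pow_eq_zero {a b : ℝ} (k : Fin n) (x : Fin n → ℝ) {m : ℕ} {g : Smooth n}
    (h : ∀ τ ∈ Ioo a b, ((Smooth.pd k ^ m) g).1 (Function.update x k τ) = 0) :
    ∃ p : Polynomial ℝ, p.degree < m ∧ ∀ τ ∈ Ioo a b, g.1 (Function.update x k τ) = p.eval τ := by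
  induction m generalizing g with
  | zero => exact ⟨0, by simp, fun τ hτ => by simpa using h τ hτ⟩
  | succ m ih =>
    rw [pow_succ] at h
    obtain ⟨p, hp, hpg⟩ := ih h
    obtain ⟨P, rfl, hP⟩ := exists_derivative_eq hp
    have hd : ∀ τ ∈ Ioo a b, HasDerivAt (fun r => g.1 (Function.update x k r) - P.eval r) 0 τ := by
      intro τ hτ
      have := (hasDerivAt_update g k x τ).sub (P.hasDerivAt τ)
      rwa [hpg τ hτ, sub_self] at this
    obtain ⟨C, hC⟩ := isOpen_Ioo.exists_is_const_of_deriv_eq_zero isPreconnected_Ioo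
      (fun τ hτ => (hd τ hτ).differentiableAt.differentiableWithinAt)
      (fun τ hτ => (hd τ hτ).deriv)
    refine ⟨P + Polynomial.C C, ?_, fun τ hτ => ?_⟩
    · refine (Polynomial.degree_add_le _ _).trans_lt (max_lt hP ?_)
      exact Polynomial.degree_C_le.trans_lt (by exact_mod_cast Nat.succ_pos m)
    · have := hC τ hτ
      simp only [Polynomial.eval_add, Polynomial.eval_C]
      linarith

/-- Along each line in the direction `k`, `g` is a polynomial of degree `< α k`, hence its own
interpolant at `α k` distinct nodes. -/
theorem smoothErr_eq_zero (hs : 0 < s) (ht : ∀ k i, |t k i - c k| < s)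
    (hinj : ∀ k, Function.Injective (t k)) (k : Fin n) {g : Smooth n}
    (h : ∀ x ∈ cube c s, ((Smooth.pd k ^ α k) g).1 x = 0) {x : Fin n → ℝ} (hx : x ∈ cube c s) :
    (smoothErr t α k g).1 x = 0 := by
  have hI : ∀ τ, |τ - c k| < s → τ ∈ Ioo (c k - s) (c k + s) := fun τ hτ => by
    rw [abs_sub_lt_iff] at hτ
    constructor <;> linarith
  have hI' : ∀ τ ∈ Ioo (c k - s) (c k + s), |τ - c k| < s := fun τ hτ => by
    rw [abs_sub_lt_iff]
    constructor <;> linarith [hτ.1, hτ.2]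
  obtain ⟨p, hp, hpg⟩ := exists_poly_of_pd_pow_eq_zero (a := c k - s) (b := c k + s) k x
    fun τ hτ => h _ (update_mem_cube hs k (hI' τ hτ) hx)
  have hx1 := hpg (x k) (hI _ ((mem_cube hs).1 hx k))
  rw [Function.update_eq_self] at hx1
  change g.1 x - interp t α k g.1 x = 0
  rw [hx1, sub_eq_zero]
  conv_lhs => rw [Lagrange.eq_interpolate (s := Finset.range (α k)) (f := p) (hinj k).injOn (by simpa using hp)]
  rw [Lagrange.interpolate_apply, Polynomial.eval_finsetSum]
  refine Finset.sum_congr rfl fun i _ => ?_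
  rw [Polynomial.eval_mul, Polynomial.eval_C, hpg _ (hI _ (ht k i))]

/-- By `commute_smoothErr`, the error operator in `x k` can be applied after the derivatives in the
remaining variables, which are distinct from `x k`. It then acts on a function killed by `∂ₖ^(α k)`
and gives zero, so the induction continues with the error of `g`. -/
theorem interpErr_eq_zero_of_prod (hs : 0 < s) (ht : ∀ k i, |t k i - c k| < s)
    (hinj : ∀ k, Function.Injective (t k)) {l : List (Fin n)} (hl : l.Nodup) {g : Smooth n}
    (h : ∀ x ∈ cube c s, ((l.map fun k => Smooth.pd k ^ α k).prod g).1 x = 0) {x : Fin n → ℝ}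
    (hx : x ∈ cube c s) : interpErr t α l g.1 x = 0 := by
  induction l generalizing g with
  | nil => exact h x hx
  | cons k l ih =>
    rw [List.nodup_cons] at hl
    refine ih (g := smoothErr t α k g) hl.2 fun y hy => ?_
    have hc : Commute (smoothErr t α k) (l.map fun k => Smooth.pd k ^ α k).prod := by
      refine Commute.list_prod_right _ _ fun A hA => ?_
      obtain ⟨j, hj, rfl⟩ := List.mem_map.1 hA
      exact (commute_smoothErr fun hkj => hl.1 (by rwa [hkj])).pow_right _
    rw [← Module.End.mul_apply, ← hc.eq]
    exact smoothErr_eq_zero hs ht hinj k (fun z hz => by simpa using h z hz) hy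

theorem interpErr_eq_zero (hs : 0 < s) (ht : ∀ k i, |t k i - c k| < s)
    (hinj : ∀ k, Function.Injective (t k)) {g : Smooth n}
    (h : ∀ x ∈ cube c s, (multiPow Smooth.pd α g).1 x = 0) {x : Fin n → ℝ}
    (hx : x ∈ cube c s) : interpErr t α (List.finRange n) g.1 x = 0 := by
  refine interpErr_eq_zero_of_prod hs ht hinj (List.nodup_finRange n) (fun y hy => ?_) hx
  rw [← h y hy, multiPow, List.ofFn_eq_map]

end Interp

/-! ## Mollification and the kernel of `D^α ∘ λ` -/

theorem multiPow_neg {R E : Type*} [CommRing R] [AddCommGroup E] [Module R E]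
    (d : Fin n → Module.End R E) (α : Fin n → ℕ) :
    multiPow (fun k => -d k) α = (-1 : R) ^ (∑ k, α k) • multiPow d α := by
  induction n with
  | zero => simp [multiPow]
  | succ n ih =>
    rw [multiPow_succ, ih, multiPow_succ, Fin.sum_univ_succ, ← neg_one_smul R (d 0), smul_pow,
      smul_mul_smul_comm, pow_add]

/-- The convolution of test functions with a locally integrable function. -/
def convSmooth {g : (Fin n → ℝ) → ℝ} (hg : LocallyIntegrable g) (W : Opens (Fin n → ℝ)) :
    𝓓(W, ℝ) →ₗ[ℝ] Smooth n where
  toFun φ := ⟨convolution g φ (ContinuousLinearMap.lsmul ℝ ℝ).flip volume,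
    φ.hasCompactSupport.contDiff_convolution_right _ hg φ.contDiff⟩
  map_add' φ ψ := Subtype.ext <| ConvolutionExists.distrib_add
    (φ.hasCompactSupport.convolutionExists_right _ hg φ.continuous)
    (ψ.hasCompactSupport.convolutionExists_right _ hg ψ.continuous)
  map_smul' _ _ := Subtype.ext convolution_smul

theorem convSmooth_apply {g : (Fin n → ℝ) → ℝ} (hg : LocallyIntegrable g) {W : Opens (Fin n → ℝ)}
    (φ : 𝓓(W, ℝ)) (x : Fin n → ℝ) : (convSmooth hg W φ).1 x = ∫ y, φ (x - y) * g y := rfl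

theorem convSmooth_tderiv {g : (Fin n → ℝ) → ℝ} (hg : LocallyIntegrable g)
    {W : Opens (Fin n → ℝ)} (k : Fin n) (φ : 𝓓(W, ℝ)) :
    convSmooth hg W (tderiv W k φ) = Smooth.pd k (convSmooth hg W φ) := by
  refine Subtype.ext <| funext fun x => ?_
  have h := φ.hasCompactSupport.hasFDerivAt_convolution_right
    (ContinuousLinearMap.lsmul ℝ ℝ).flip hg (φ.contDiff.of_le (by simp)) x
  rw [Smooth.pd_apply]
  change _ = fderiv ℝ (convolution g φ (ContinuousLinearMap.lsmul ℝ ℝ).flip volume) x _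
  rw [h.fderiv, convolution_precompR_apply _ hg (φ.hasCompactSupport.fderiv ℝ)
    (φ.contDiff.continuous_fderiv (by simp))]
  simp only [convSmooth_apply, convolution_def]
  refine integral_congr_ae (Filter.Eventually.of_forall fun y => ?_)
  simp only [tderiv_apply]
  rfl

/-- The reflection `φ ↦ φ(x - ·)` of test functions. -/
def reflectTest {W V : Opens (Fin n → ℝ)} (x : Fin n → ℝ) (h : ∀ y, x - y ∈ W → y ∈ V) :
    𝓓(W, ℝ) →ₗ[ℝ] 𝓓(V, ℝ) where
  toFun φ := ⟨fun y => φ (x - y), φ.contDiff.comp (contDiff_const.sub contDiff_id),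
    φ.hasCompactSupport.comp_homeomorph (Homeomorph.subLeft x), by
      have := tsupport_comp_eq_preimage φ (Homeomorph.subLeft x)
      change tsupport (φ ∘ Homeomorph.subLeft x) ⊆ _
      rw [this]
      exact fun y hy => h y (φ.tsupport_subset hy)⟩
  map_add' _ _ := rfl
  map_smul' _ _ := rfl

theorem reflectTest_tderiv {W V : Opens (Fin n → ℝ)} (x : Fin n → ℝ)
    (h : ∀ y, x - y ∈ W → y ∈ V) (k : Fin n) (φ : 𝓓(W, ℝ)) :
    reflectTest x h (tderiv W k φ) = (-tderiv V k) (reflectTest x h φ) := by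
  refine TestFunction.ext fun y => ?_
  change tderiv W k φ (x - y) = - tderiv V k (reflectTest x h φ) y
  rw [tderiv_apply, tderiv_apply]
  change _ = - fderiv ℝ (fun z => φ (x - z)) y _
  have h1 := ((φ.contDiff.differentiable (by simp)) (x - y)).hasFDerivAt.comp y
    ((hasFDerivAt_id y).const_sub x)
  have h2 : fderiv ℝ (fun z => φ (x - z)) y = _ := h1.fderiv
  rw [h2]
  simp

/-- Differentiating under the convolution pairs `f` with the reflection of `∂^α φ`. The sign from
the reflection is exactly the one in the definition of `D^α`, so the value is `D^α λ(f)` tested on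
`φ(x - ·)`. -/
theorem multiPow_convSmooth_eq_zero {V W : Opens (Fin n → ℝ)} {f : C(V, ℝ)} {α : Fin n → ℕ}
    (hf : multiPow (fun k => dderivLin k V) α (lamLin V f) = 0) {g : (Fin n → ℝ) → ℝ}
    (hg : LocallyIntegrable g) {x : Fin n → ℝ} (hx : ∀ y, x - y ∈ W → y ∈ V ∧ g y = zeroExt f y)
    (φ : 𝓓(W, ℝ)) : (multiPow Smooth.pd α (convSmooth hg W φ)).1 x = 0 := by
  have hx' : ∀ y, x - y ∈ W → y ∈ V := fun y hy => (hx y hy).1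
  rw [← multiPow_intertwine _ (convSmooth_tderiv hg), convSmooth_apply]
  set φ' := multiPow (tderiv W) α φ with hφ'
  have h1 : ∫ y, φ' (x - y) * g y = regular f (reflectTest x hx' φ') := by
    rw [regular_apply]
    refine integral_congr_ae (Filter.Eventually.of_forall fun y => ?_)
    change φ' (x - y) * g y = φ' (x - y) * zeroExt f y
    by_cases hy : x - y ∈ W
    · rw [(hx y hy).2]
    · rw [image_eq_zero_of_notMem_tsupport fun h => hy (φ'.tsupport_subset h), zero_mul, zero_mul]
  rw [h1, hφ', multiPow_intertwine _ (reflectTest_tderiv x hx'), multiPow_neg,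
    LinearMap.smul_apply, map_smul]
  have h2 := multiPow_dderivLin_apply α (lamLin V f) (reflectTest x hx' φ)
  rw [hf] at h2
  exact h2.symm

theorem interpErr_zeroExt_eq_zero {c : Fin n → ℝ} {r s : ℝ} (hs : 0 < s) (hsr : s < r)
    {t : Fin n → ℕ → ℝ} (ht : ∀ k i, |t k i - c k| < s) (hinj : ∀ k, Function.Injective (t k))
    {α : Fin n → ℕ} {f : C(cube c r, ℝ)}
    (hf : multiPow (fun k => dderivLin k (cube c r)) α (lamLin _ f) = 0) {x : Fin n → ℝ}
    (hx : x ∈ cube c s) : interpErr t α (List.finRange n) (zeroExt f) x = 0 := by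
  -- The intermediate radius makes the truncation `g` of `f` integrable on all of `ℝⁿ`; mollifying
  -- at scale below `s' - s`, points of the cube of radius `s` see only values where `g = f`.
  obtain ⟨s', hss', hs'r⟩ := exists_between hsr
  have hsub : Metric.closedBall c s' ⊆ cube c r := Metric.closedBall_subset_ball hs'r
  let g : (Fin n → ℝ) → ℝ := (Metric.closedBall c s').indicator (zeroExt f)
  have hgi : Integrable g := by
    refine IntegrableOn.integrable_indicator ?_ Metric.isClosed_closedBall.measurableSet
    exact ((continuousOn_zeroExt f).mono hsub).integrableOn_compact (isCompact_closedBall c s')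
  have hg : LocallyIntegrable g := hgi.locallyIntegrable
  have hgeq : ∀ y ∈ Metric.closedBall c s', g y = zeroExt f y := fun y hy => indicator_of_mem hy _
  have hδ : 0 < s' - s := sub_pos.2 hss'
  -- Dividing by `j + 2` keeps the outer radius strictly below `s' - s` even for `j = 0`.
  let ρ : ℕ → ContDiffBump (0 : Fin n → ℝ) := fun j =>
    { rIn := (s' - s) / (j + 2) / 2
      rOut := (s' - s) / (j + 2)
      rIn_pos := by positivity
      rIn_lt_rOut := half_lt_self (by positivity) }
  have hρ : ∀ j, (ρ j).rOut < s' - s := fun j => by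
    refine div_lt_self hδ ?_
    have : (0 : ℝ) ≤ j := Nat.cast_nonneg j
    linarith
  have hρ0 : Filter.Tendsto (fun j => (ρ j).rOut) Filter.atTop (nhds 0) :=
    Filter.Tendsto.div_atTop tendsto_const_nhds
      (Filter.tendsto_atTop_add_const_right _ _ tendsto_natCast_atTop_atTop)
  let Φ : ℕ → 𝓓(cube (0 : Fin n → ℝ) (s' - s), ℝ) := fun j =>
    ⟨(ρ j).normed volume, (ρ j).contDiff_normed, (ρ j).hasCompactSupport_normed, by
      rw [(ρ j).tsupport_normed_eq]
      exact Metric.closedBall_subset_ball (hρ j)⟩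
  have hlim : ∀ y ∈ cube c s, Filter.Tendsto (fun j => (convSmooth hg _ (Φ j)).1 y) Filter.atTop
      (nhds (zeroExt f y)) := by
    intro y hy
    have hy' : y ∈ Metric.ball c s' := Metric.ball_subset_ball hss'.le hy
    have hcont : ContinuousAt g y := by
      have h1 : ContinuousAt (zeroExt f) y := (continuousOn_zeroExt f).continuousAt
        ((cube c r).isOpen.mem_nhds (hsub (Metric.ball_subset_closedBall hy')))
      refine h1.congr ?_
      filter_upwards [Metric.isOpen_ball.mem_nhds hy'] with z hz
      exact (hgeq z (Metric.ball_subset_closedBall hz)).symm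
    have h2 := ContDiffBump.convolution_tendsto_right (μ := volume) (φ := ρ) (g := fun _ => g)
      (k := fun _ => y) (x₀ := y) hρ0 (Filter.Eventually.of_forall fun _ => hgi.1)
      (hcont.tendsto.comp Filter.tendsto_snd) tendsto_const_nhds
    rw [hgeq y (Metric.ball_subset_closedBall hy')] at h2
    refine h2.congr fun j => ?_
    exact (congrFun (convolution_flip (L := ContinuousLinearMap.lsmul ℝ ℝ) (f := (ρ j).normed volume)
      (g := g) (μ := volume)) y).symm
  have hzero : ∀ j, interpErr t α (List.finRange n) (convSmooth hg _ (Φ j)).1 x = 0 := by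
    intro j
    refine interpErr_eq_zero hs ht hinj (fun y hy => ?_) hx
    refine multiPow_convSmooth_eq_zero hf hg (fun z hz => ?_) _
    have hz' : z ∈ Metric.closedBall c s' := by
      have h1 : dist (y - z) 0 < s' - s := hz
      have h2 : dist y c < s := hy
      rw [dist_zero_right, ← dist_eq_norm] at h1
      have h3 := dist_triangle z y c
      rw [dist_comm z y] at h3
      exact Metric.mem_closedBall.2 (by linarith)
    exact ⟨hsub hz', hgeq z hz'⟩
  have := tendsto_interpErr (α := α) hs ht (List.finRange n) hlim hx
  simp only [hzero] at this
  exact (tendsto_nhds_unique this tendsto_const_nhds)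

theorem exists_eq_sum_isPolyInVar {V : Opens (Fin n → ℝ)} (hV : IsInterval V) {α : Fin n → ℕ}
    {f : C(V, ℝ)} (hf : multiPow (fun k => dderivLin k V) α (lamLin V f) = 0) :
    ∃ θ : Fin n → C(V, ℝ), f = ∑ k, θ k ∧ ∀ k, IsPolyInVar k (α k) (θ k) := by
  obtain ⟨c, r, hr, rfl⟩ := hV.exists_eq_cube
  -- All nodes lie within `r / 2` of the center and do not depend on `s`. One decomposition thus
  -- serves on the whole interval, while the vanishing of the remainder at a given `x` is checked in
  -- a smaller cube containing `x` and every node.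
  let t : Fin n → ℕ → ℝ := fun k i => c k + r / (i + 2)
  have ht : ∀ k i, |t k i - c k| ≤ r / 2 := fun k i => by
    simp only [t, add_sub_cancel_left]
    rw [abs_of_pos (by positivity)]
    refine div_le_div_of_nonneg_left hr.le (by norm_num) ?_
    have : (0 : ℝ) ≤ i := Nat.cast_nonneg i
    linarith
  have hinj : ∀ k, Function.Injective (t k) := fun k i j hij => by
    simp only [t, add_right_inj] at hij
    rw [div_eq_div_iff (by positivity) (by positivity)] at hij
    have := mul_left_cancel₀ hr.ne' hij
    exact_mod_cast (add_right_cancel this).symm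
  obtain ⟨θ, hθ, h⟩ := exists_eq_interpErr_add (α := α) hr
    (fun k i => (ht k i).trans_lt (half_lt_self hr)) hinj (List.finRange n) (continuousOn_zeroExt f)
  refine ⟨θ, ContinuousMap.ext fun x => ?_, hθ⟩
  have hx : max (dist x.1 c) (r / 2) < r := max_lt x.2 (half_lt_self hr)
  obtain ⟨s, hs1, hs2⟩ := exists_between hx
  have hs : r / 2 < s := (le_max_right _ _).trans_lt hs1
  have h0 := interpErr_zeroExt_eq_zero (by linarith) hs2 (fun k i => (ht k i).trans_lt hs) hinj hf
    (x := x.1) ((le_max_left _ _).trans_lt hs1)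
  have h1 := h x
  rw [h0, zero_add, zeroExt_apply f x.2] at h1
  simpa using h1

theorem distTriple_minimalKernel : (distTriple.{u} n).MinimalKernel := fun V hV α _ h =>
  exists_eq_sum_isPolyInVar hV (congrArg ULift.down ((distTriple_multiPow V α _).symm.trans h))

/-! ## A fundamental solution -/

/-- The kernel `∏ₖ (yₖ - zₖ)₊`, a fundamental solution of `∂₁² ⋯ ∂ₙ²`. -/
def rampKernel (y z : Fin n → ℝ) : ℝ := ∏ k, max (y k - z k) 0

theorem continuous_rampKernel :
    Continuous fun p : (Fin n → ℝ) × (Fin n → ℝ) => rampKernel p.2 p.1 := by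
  unfold rampKernel
  fun_prop

theorem hasLineDerivAt_test {U : Opens (Fin n → ℝ)} (φ : 𝓓(U, ℝ)) (k : Fin n) (x : Fin n → ℝ) :
    HasLineDerivAt ℝ φ (tderiv U k φ x) x (Pi.single k 1) := by
  have := Smooth.hasLineDerivAt (testToSmooth U φ) k x
  rwa [← testToSmooth_tderiv] at this

theorem isClosedEmbedding_cons_left (z : Fin n → ℝ) :
    Topology.IsClosedEmbedding fun t : ℝ => (Fin.cons t z : Fin (n + 1) → ℝ) :=
  Function.LeftInverse.isClosedEmbedding (f := fun x : Fin (n + 1) → ℝ => x 0) (fun _ => rfl)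
    (continuous_apply 0)
    (continuous_pi fun l => by refine Fin.cases ?_ (fun l => ?_) l <;> simp <;> fun_prop)

theorem isClosedEmbedding_cons_right (t : ℝ) :
    Topology.IsClosedEmbedding fun z : Fin n → ℝ => (Fin.cons t z : Fin (n + 1) → ℝ) :=
  Function.LeftInverse.isClosedEmbedding (f := fun x : Fin (n + 1) → ℝ => fun k => x k.succ)
    (fun _ => rfl) (by fun_prop)
    (continuous_pi fun l => by refine Fin.cases ?_ (fun l => ?_) l <;> simp <;> fun_prop)

theorem contDiff_cons_left (z : Fin n → ℝ) :
    ContDiff ℝ (⊤ : ℕ∞) fun t : ℝ => (Fin.cons t z : Fin (n + 1) → ℝ) :=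
  contDiff_pi.2 fun l => by refine Fin.cases ?_ (fun l => ?_) l <;> simp <;> fun_prop

theorem contDiff_cons_right (t : ℝ) :
    ContDiff ℝ (⊤ : ℕ∞) fun z : Fin n → ℝ => (Fin.cons t z : Fin (n + 1) → ℝ) :=
  contDiff_pi.2 fun l => by refine Fin.cases ?_ (fun l => ?_) l <;> simp <;> fun_prop

/-- The restriction of test functions to the hyperplane `x₀ = t`. -/
def sliceTest (t : ℝ) : 𝓓((⊤ : Opens (Fin (n + 1) → ℝ)), ℝ) →ₗ[ℝ]
    𝓓((⊤ : Opens (Fin n → ℝ)), ℝ) where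
  toFun φ := ⟨fun z => φ (Fin.cons t z), φ.contDiff.comp (contDiff_cons_right t),
    φ.hasCompactSupport.comp_isClosedEmbedding (isClosedEmbedding_cons_right t), subset_univ _⟩
  map_add' _ _ := rfl
  map_smul' _ _ := rfl

theorem sliceTest_tderiv (t : ℝ) (k : Fin n) (φ : 𝓓((⊤ : Opens (Fin (n + 1) → ℝ)), ℝ)) :
    sliceTest t (tderiv ⊤ k.succ φ) = tderiv ⊤ k (sliceTest t φ) := by
  refine TestFunction.ext fun z => ?_
  refine HasLineDerivAt.unique ?_ (hasLineDerivAt_test (sliceTest t φ) k z)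
  refine HasDerivAt.congr_of_eventuallyEq (hasLineDerivAt_test φ k.succ (Fin.cons t z))
    (Filter.Eventually.of_forall fun r => ?_)
  refine congrArg φ (funext fun l => ?_)
  refine Fin.cases ?_ (fun l => ?_) l
  · simp [(Fin.succ_ne_zero k).symm]
  · simp [Pi.single_apply]

theorem hasDerivAt_cons (φ : 𝓓((⊤ : Opens (Fin (n + 1) → ℝ)), ℝ)) (z : Fin n → ℝ) (t : ℝ) :
    HasDerivAt (fun t => φ (Fin.cons t z)) (tderiv ⊤ 0 φ (Fin.cons t z)) t := by
  have := hasDerivAt_update (testToSmooth ⊤ φ) 0 (Fin.cons 0 z) t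
  rw [← testToSmooth_tderiv] at this
  simp only [Fin.update_cons_zero] at this
  exact this

/-- On `t ≤ a` the integrand is the derivative of `(a - t) ∂₀φ + φ`, which has compact support and
equals `φ` at `t = a`. -/
theorem integral_ramp_mul (φ : 𝓓((⊤ : Opens (Fin (n + 1) → ℝ)), ℝ)) (z : Fin n → ℝ) (a : ℝ) :
    ∫ t, max (a - t) 0 * tderiv ⊤ 0 (tderiv ⊤ 0 φ) (Fin.cons t z) = φ (Fin.cons a z) := by
  have hs : ∀ ψ : 𝓓((⊤ : Opens (Fin (n + 1) → ℝ)), ℝ),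
      HasCompactSupport fun t => ψ (Fin.cons t z) := fun ψ =>
    ψ.hasCompactSupport.comp_isClosedEmbedding (isClosedEmbedding_cons_left z)
  have hc : ∀ ψ : 𝓓((⊤ : Opens (Fin (n + 1) → ℝ)), ℝ),
      ContDiff ℝ (⊤ : ℕ∞) fun t => ψ (Fin.cons t z) := fun ψ =>
    ψ.contDiff.comp (contDiff_cons_left z)
  let w : ℝ → ℝ := fun t => (a - t) * tderiv ⊤ 0 φ (Fin.cons t z) + φ (Fin.cons t z)
  have hw : ContDiff ℝ (⊤ : ℕ∞) w :=
    ((contDiff_const.sub contDiff_id).mul (hc _)).add (hc φ)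
  have hws : HasCompactSupport w := ((hs (tderiv ⊤ 0 φ)).mul_left).add (hs φ)
  have hwd : ∀ t, deriv w t = (a - t) * tderiv ⊤ 0 (tderiv ⊤ 0 φ) (Fin.cons t z) := by
    intro t
    have h1 := (((hasDerivAt_id t).const_sub a).mul (hasDerivAt_cons (tderiv ⊤ 0 φ) z t)).add
      (hasDerivAt_cons φ z t)
    refine h1.deriv.trans ?_
    simp
  have key := hws.integral_Iic_deriv_eq (hw.of_le (by simp)) a
  have hwa : w a = φ (Fin.cons a z) := by simp [w]
  rw [← hwa, ← key, ← integral_indicator measurableSet_Iic]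
  refine integral_congr_ae (Filter.Eventually.of_forall fun t => ?_)
  simp only [indicator_apply, mem_Iic, hwd]
  split_ifs with ht
  · rw [max_eq_left (by linarith)]
  · rw [max_eq_right (by linarith [not_le.1 ht]), zero_mul]

/-- By Fubini, integrate in the first variable with `integral_ramp_mul`; what remains is the same
identity, one dimension lower, for the slice of `φ` at `y 0`. -/
theorem integral_rampKernel_mul (φ : 𝓓((⊤ : Opens (Fin n → ℝ)), ℝ)) (y : Fin n → ℝ) :
    ∫ z, rampKernel y z * multiPow (tderiv ⊤) (fun _ => 2) φ z = φ y := by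
  induction n with
  | zero =>
    -- In dimension zero the space is one point of mass `1` and the kernel is the empty product.
    rw [integral_unique]
    simp only [rampKernel, multiPow, List.ofFn_zero, List.prod_nil, Finset.univ_eq_empty,
      Finset.prod_empty, Module.End.one_apply]
    simp only [Measure.real, volume_pi, Measure.pi_univ, Finset.univ_eq_empty, Finset.prod_empty,
      ENNReal.toReal_one, one_smul, one_mul]
    exact congrArg φ (Subsingleton.elim _ _)
  | succ n ih =>
    set ψ := multiPow (fun k : Fin n => tderiv (⊤ : Opens (Fin (n + 1) → ℝ)) k.succ) (fun _ => 2) φ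
      with hψ
    have hdec : ∀ z, multiPow (tderiv (⊤ : Opens (Fin (n + 1) → ℝ))) (fun _ => 2) φ z =
        tderiv ⊤ 0 (tderiv ⊤ 0 ψ) z := by
      intro z
      rw [multiPow_succ, Module.End.mul_apply, pow_two, Module.End.mul_apply]
    let e := MeasurableEquiv.piFinSuccAbove (fun _ : Fin (n + 1) => ℝ) 0
    have he : MeasurePreserving e.symm :=
      (volume_preserving_piFinSuccAbove (fun _ : Fin (n + 1) => ℝ) 0).symm
    have hes : ∀ p : ℝ × (Fin n → ℝ), e.symm p = Fin.cons p.1 p.2 := fun p => by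
      simp only [e, MeasurableEquiv.piFinSuccAbove_symm_apply]
      exact Fin.insertNth_zero' p.1 p.2
    have hint : Integrable fun z => rampKernel y z * tderiv ⊤ 0 (tderiv ⊤ 0 ψ) z := by
      refine Continuous.integrable_of_hasCompactSupport ?_ ?_
      · exact (continuous_rampKernel.comp (Continuous.prodMk_left y)).mul
          (tderiv ⊤ 0 (tderiv ⊤ 0 ψ)).continuous
      · exact (tderiv ⊤ 0 (tderiv ⊤ 0 ψ)).hasCompactSupport.mul_left
    simp only [hdec]
    rw [← he.integral_comp' (g := fun z => rampKernel y z * tderiv ⊤ 0 (tderiv ⊤ 0 ψ) z)]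
    have hint' := (he.integrable_comp_emb e.symm.measurableEmbedding).2 hint
    rw [Measure.volume_eq_prod] at hint' ⊢
    refine (integral_prod_symm _ hint').trans ?_
    simp only [Function.comp_apply]
    have hr : ∀ (t : ℝ) (z : Fin n → ℝ), rampKernel y (Fin.cons t z) =
        max (y 0 - t) 0 * rampKernel (fun k => y k.succ) z := fun t z => by
      simp [rampKernel, Fin.prod_univ_succ]
    have hinner : ∀ z : Fin n → ℝ, ∫ t, rampKernel y (Fin.cons t z) *
        tderiv ⊤ 0 (tderiv ⊤ 0 ψ) (Fin.cons t z) =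
        rampKernel (fun k => y k.succ) z * ψ (Fin.cons (y 0) z) := by
      intro z
      rw [← integral_ramp_mul, ← integral_const_mul]
      refine integral_congr_ae (Filter.Eventually.of_forall fun t => ?_)
      simp only [hr]
      ring
    simp only [hes, hinner]
    have hsl : ∀ z, ψ (Fin.cons (y 0) z) =
        multiPow (tderiv ⊤) (fun _ => 2) (sliceTest (y 0) φ) z := fun z => by
      rw [← multiPow_intertwine (sliceTest (y 0)) (sliceTest_tderiv (y 0)), ← hψ]
      rfl
    simp only [hsl, ih]
    change φ (Fin.cons (y 0) fun k => y k.succ) = φ y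
    exact congrArg φ (Fin.cons_self_tail y)

/-! ## Distributions are locally derivatives of continuous functions -/

section Bounds

variable {c : Fin n → ℝ} {r : ℝ}

theorem test_eq_zero {U : Opens (Fin n → ℝ)} (φ : 𝓓(U, ℝ)) {x : Fin n → ℝ} (hx : x ∉ U) :
    φ x = 0 :=
  image_eq_zero_of_notMem_tsupport fun h => hx (φ.tsupport_subset h)

/-- `φ` vanishes on the face `x k = c k + r`, at distance at most `2 * r` from `x` in the direction
`k`; the mean value inequality does the rest. -/
theorem abs_le_of_tderiv (hr : 0 < r) (k : Fin n) {φ : 𝓓(cube c r, ℝ)} {M : ℝ}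
    (h : ∀ x, |tderiv _ k φ x| ≤ M) (x : Fin n → ℝ) : |φ x| ≤ 2 * r * M := by
  have hM : 0 ≤ M := (abs_nonneg _).trans (h x)
  by_cases hx : x ∈ cube c r
  · have hx' := abs_sub_lt_iff.1 ((mem_cube hr).1 hx k)
    have h0 : φ (Function.update x k (c k + r)) = 0 := by
      refine test_eq_zero φ fun h' => ?_
      have := (mem_cube hr).1 h' k
      simp [abs_of_pos hr] at this
    have hd : ∀ τ, HasDerivAt (fun τ => φ (Function.update x k τ))
        (tderiv _ k φ (Function.update x k τ)) τ := fun τ => by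
      have := hasDerivAt_update (testToSmooth _ φ) k x τ
      rw [← testToSmooth_tderiv] at this
      exact this
    have := Convex.norm_image_sub_le_of_norm_hasDerivWithin_le (s := univ) (x := c k + r)
      (y := x k) (fun τ _ => (hd τ).hasDerivWithinAt) (fun τ _ => h _) convex_univ (mem_univ _)
      (mem_univ _)
    rw [h0, Function.update_eq_self, sub_zero, Real.norm_eq_abs, Real.norm_eq_abs]
      at this
    have h3 : |x k - (c k + r)| ≤ 2 * r := by
      rw [abs_le]
      constructor <;> linarith [hx'.1, hx'.2]
    rw [mul_comm]
    exact this.trans (mul_le_mul_of_nonneg_left h3 hM)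
  · rw [test_eq_zero φ hx, abs_zero]
    positivity

theorem abs_le_of_multiPow (hr : 0 < r) (γ : Fin n → ℕ) {φ : 𝓓(cube c r, ℝ)} {M : ℝ}
    (h : ∀ x, |multiPow (tderiv _) γ φ x| ≤ M) (x : Fin n → ℝ) :
    |φ x| ≤ (2 * r) ^ (∑ k, γ k) * M := by
  induction γ using multiIndex_induction generalizing φ M x with
  | zero => simpa [multiPow_zero] using h x
  | add_single γ k ih =>
    rw [add_comm, multiPow_add commute_tderiv, multiPow_single, pow_one] at h
    have := ih (abs_le_of_tderiv hr k h) x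
    refine this.trans (le_of_eq ?_)
    simp only [Pi.add_apply, Finset.sum_add_distrib, Finset.sum_pi_single', Finset.mem_univ,
      if_true, pow_add, pow_one]
    ring

theorem fderiv_eq_sum_tderiv {U : Opens (Fin n → ℝ)} (φ : 𝓓(U, ℝ)) :
    fderiv ℝ φ = fun x => ∑ k, (ContinuousLinearMap.smulRightL ℝ (Fin n → ℝ) ℝ
      (ContinuousLinearMap.proj k)) (tderiv U k φ x) := by
  funext x
  refine ContinuousLinearMap.ext fun v => ?_
  conv_lhs => rw [pi_eq_sum_univ' v, map_sum]
  rw [sum_apply]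
  refine Finset.sum_congr rfl fun k _ => ?_
  rw [map_smul]
  simp only [ContinuousLinearMap.smulRightL_apply_apply, ContinuousLinearMap.smulRight_apply,
    ContinuousLinearMap.proj_apply, tderiv_apply]

/-- A partial derivative of total order `i` has order at most `i` in each variable, so by
`abs_le_of_multiPow` it is controlled by the single mixed derivative of order `(i, …, i)`. -/
theorem exists_norm_iteratedFDeriv_le (c : Fin n → ℝ) (hr : 0 < r) (i : ℕ) :
    ∃ C, 0 ≤ C ∧ ∀ (φ : 𝓓(cube c r, ℝ)) (M : ℝ),
      (∀ x, |multiPow (tderiv _) (fun _ => i) φ x| ≤ M) →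
        ∀ x, ‖iteratedFDeriv ℝ i φ x‖ ≤ C * M := by
  induction i with
  | zero =>
    refine ⟨1, zero_le_one, fun φ M h x => ?_⟩
    rw [norm_iteratedFDeriv_zero, one_mul]
    have : multiPow (tderiv (cube c r)) (fun _ => 0) = 1 := multiPow_zero _
    simpa [this] using h x
  | succ i ih =>
    obtain ⟨C, hC, ih⟩ := ih
    let L : Fin n → ℝ →L[ℝ] (Fin n → ℝ) →L[ℝ] ℝ := fun k =>
      ContinuousLinearMap.smulRightL ℝ (Fin n → ℝ) ℝ (ContinuousLinearMap.proj k)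
    -- The derivatives missing after `∂ₖ` in passing from order `(i, …, i)` to `(i + 1, …, i + 1)`:
    -- one in each variable other than `k`.
    let γ : Fin n → Fin n → ℕ := fun k => (fun _ => 1) - Pi.single k 1
    refine ⟨∑ k, ‖L k‖ * (C * (2 * r) ^ (∑ l, γ k l)), by positivity, fun φ M h x => ?_⟩
    have hcd : ∀ k, ContDiff ℝ (⊤ : ℕ∞) fun x => L k (tderiv _ k φ x) := fun k =>
      (L k).contDiff.comp (tderiv _ k φ).contDiff
    rw [← norm_iteratedFDeriv_fderiv, fderiv_eq_sum_tderiv,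
      iteratedFDeriv_sum fun k _ => (hcd k).of_le (by exact_mod_cast le_top), Finset.sum_apply,
      Finset.sum_mul]
    refine (norm_sum_le _ _).trans (Finset.sum_le_sum fun k _ => ?_)
    have h1 := ContinuousLinearMap.norm_iteratedFDeriv_comp_left (L k) (n := i) (x := x)
      (tderiv _ k φ).contDiff.contDiffAt (by exact_mod_cast le_top)
    refine h1.trans ?_
    rw [mul_assoc, mul_assoc]
    refine mul_le_mul_of_nonneg_left (ih _ _ (fun y => ?_) x) (norm_nonneg _)
    refine abs_le_of_multiPow hr (γ k) (fun z => ?_) y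
    have hdec : (fun _ => i + 1 : Fin n → ℕ) = γ k + ((fun _ => i) + Pi.single k 1) := by
      funext l
      rcases eq_or_ne l k with rfl | hl
      · simp [γ]
      · simp [γ, hl, add_comm]
    have h2 := h z
    rw [hdec, multiPow_add commute_tderiv, multiPow_add commute_tderiv, multiPow_single,
      pow_one] at h2
    exact h2

theorem exists_norm_iteratedFDeriv_le_of_le (c : Fin n → ℝ) (hr : 0 < r) {i m : ℕ} (him : i ≤ m) :
    ∃ C, 0 ≤ C ∧ ∀ (φ : 𝓓(cube c r, ℝ)) (M : ℝ),
      (∀ x, |multiPow (tderiv _) (fun _ => m) φ x| ≤ M) →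
        ∀ x, ‖iteratedFDeriv ℝ i φ x‖ ≤ C * M := by
  obtain ⟨C, hC, H⟩ := exists_norm_iteratedFDeriv_le c hr i
  refine ⟨C * (2 * r) ^ (∑ _k : Fin n, (m - i)), by positivity, fun φ M h x => ?_⟩
  rw [mul_assoc]
  refine H _ _ (fun y => abs_le_of_multiPow hr (fun _ => m - i) (fun z => ?_) y) x
  rw [← Module.End.mul_apply, ← multiPow_add commute_tderiv]
  have : ((fun _ => m - i) + fun _ => i : Fin n → ℕ) = fun _ => m := by
    funext k
    simp [him]
  rw [this]
  exact h z

/-- On test functions supported in a fixed compact set, `T` is bounded by finitely many seminorms;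
`m` is the largest order among them, and the derivative of order `(m, …, m)` dominates them all. -/
theorem exists_bound (U : Opens (Fin n → ℝ)) (hr : 0 < r) (hU : Metric.closedBall c r ⊆ U)
    (T : 𝓓'(U, ℝ)) :
    ∃ (m : ℕ) (C : ℝ), ∀ (φ : 𝓓(cube c r, ℝ)) (M : ℝ),
      (∀ x, |multiPow (tderiv _) (fun _ => m) φ x| ≤ M) →
        |distRes U (cube c r) T φ| ≤ C * M := by
  let K : Compacts (Fin n → ℝ) := ⟨Metric.closedBall c r, isCompact_closedBall c r⟩
  have hcU : cube c r ≤ U := fun x hx => hU (Metric.ball_subset_closedBall hx)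
  let TK : 𝓓^{⊤}_{K}(Fin n → ℝ, ℝ) →L[ℝ] ℝ :=
    (show 𝓓(U, ℝ) →L[ℝ] ℝ from T).comp (TestFunction.ofSupportedInCLM ℝ hU)
  obtain ⟨s, C, -, hC⟩ := Seminorm.bound_of_continuous
    (ContDiffMapSupportedIn.withSeminorms ℝ (Fin n → ℝ) ℝ ⊤ K)
    ((normSeminorm ℝ ℝ).comp TK.toLinearMap) (continuous_norm.comp TK.continuous)
  let m := s.sup id
  have him : ∀ i : s, i.1 ≤ m := fun i => Finset.le_sup (f := id) i.2
  choose B hB hbound using fun i : s => exists_norm_iteratedFDeriv_le_of_le c hr (him i)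
  refine ⟨m, C * ∑ i, B i, fun φ M h => ?_⟩
  have hM : 0 ≤ M := (abs_nonneg _).trans (h 0)
  let φK : 𝓓^{⊤}_{K}(Fin n → ℝ, ℝ) := .of_support_subset φ.contDiff
    ((subset_tsupport _).trans (φ.tsupport_subset.trans Metric.ball_subset_closedBall))
  have h1 : distRes U (cube c r) T φ = TK φK := by
    rw [distRes_apply]
    refine congrArg T (TestFunction.ext fun x => ?_)
    simp only [TestFunction.monoCLM_apply, hcU, le_refl, and_self, if_true]
    rfl
  rw [h1]
  have h2 := hC φK
  change |TK φK| ≤ C * _ at h2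
  refine h2.trans ?_
  rw [mul_assoc]
  refine mul_le_mul_of_nonneg_left ?_ C.2
  refine Seminorm.finset_sup_apply_le
    (mul_nonneg (Finset.sum_nonneg fun i _ => hB i) hM) fun i hi => ?_
  have hle : B ⟨i, hi⟩ * M ≤ (∑ i, B i) * M := mul_le_mul_of_nonneg_right
    (Finset.single_le_sum (fun i _ => hB i) (Finset.mem_univ _)) hM
  refine le_trans ?_ hle
  rw [ContDiffMapSupportedIn.seminorm_top_le_iff ℝ (mul_nonneg (hB _) hM)]
  exact fun x _ => hbound ⟨i, hi⟩ φ M h x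

end Bounds

/-- The bound forces `T` to vanish on the kernel of `A`, so `T` descends to a bounded functional on
the range, here through an arbitrary linear section `g`; Hahn–Banach extends it to `F`. -/
theorem exists_clm_comp_eq {E F : Type*} [AddCommGroup E] [Module ℝ E] [NormedAddCommGroup F]
    [NormedSpace ℝ F] (A : E →ₗ[ℝ] F) (T : E →ₗ[ℝ] ℝ) (C : ℝ) (h : ∀ x, |T x| ≤ C * ‖A x‖) :
    ∃ L : F →L[ℝ] ℝ, ∀ x, L (A x) = T x := by
  obtain ⟨g, hg⟩ := A.rangeRestrict.exists_rightInverse_of_surjective A.range_rangeRestrict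
  have hg' : ∀ y, A (g y) = y := fun y => congrArg Subtype.val (LinearMap.congr_fun hg y)
  obtain ⟨L, hL, -⟩ := exists_extension_norm_eq (𝕜 := ℝ) (LinearMap.range A)
    ((T ∘ₗ g).mkContinuous C fun y => by simpa [hg'] using h (g y))
  refine ⟨L, fun x => ?_⟩
  have h1 := hL ⟨A x, x, rfl⟩
  simp only [LinearMap.mkContinuous_apply, LinearMap.comp_apply] at h1
  rw [h1, ← sub_eq_zero, ← map_sub, ← abs_nonpos_iff]
  refine (h _).trans (le_of_eq ?_)
  rw [map_sub, hg', sub_self, norm_zero, mul_zero]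

/-- Write `T = L ∘ ∂^(m,…,m)` with `L` on `C(K)`. The fundamental solution expresses `∂^(m,…,m) φ`
as a `C(K)`-valued integral of ramp kernels against `∂^(2+m,…,2+m) φ`, and `L` passes under the
integral. -/
theorem exists_integral_representation {c : Fin n → ℝ} {r : ℝ} (T : 𝓓'(cube c r, ℝ))
    (m : ℕ) (C : ℝ) (h : ∀ (φ : 𝓓(cube c r, ℝ)) (M : ℝ),
      (∀ x, |multiPow (tderiv _) (fun _ => m) φ x| ≤ M) → |T φ| ≤ C * M) :
    ∃ f : C(Fin n → ℝ, ℝ), ∀ φ : 𝓓(cube c r, ℝ),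
      T φ = ∫ z, multiPow (tderiv _) (fun _ => 2 + m) φ z * f z := by
  let K := Metric.closedBall c r
  have : CompactSpace K := isCompact_iff_compactSpace.1 (isCompact_closedBall c r)
  let A : 𝓓(cube c r, ℝ) →ₗ[ℝ] C(K, ℝ) :=
    { toFun := fun φ => ⟨fun x => multiPow (tderiv _) (fun _ => m) φ x.1,
        (multiPow (tderiv _) (fun _ => m) φ).continuous.comp continuous_subtype_val⟩
      map_add' := fun φ ψ => ContinuousMap.ext fun x => by
        simp only [map_add]
        rfl
      map_smul' := fun a φ => ContinuousMap.ext fun x => by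
        simp only [map_smul]
        rfl }
  let T' : 𝓓(cube c r, ℝ) →ₗ[ℝ] ℝ := (show 𝓓(cube c r, ℝ) →L[ℝ] ℝ from T).toLinearMap
  obtain ⟨L, hL⟩ := exists_clm_comp_eq A T' C fun φ => h φ _ fun x => by
    by_cases hx : x ∈ K
    · exact (A φ).norm_coe_le_norm ⟨x, hx⟩
    · rw [test_eq_zero _ fun hx' => hx (Metric.ball_subset_closedBall hx'), abs_zero]
      exact norm_nonneg _
  let H : C(Fin n → ℝ, C(K, ℝ)) := ContinuousMap.curry
    ⟨fun p : (Fin n → ℝ) × K => rampKernel p.2.1 p.1,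
      continuous_rampKernel.comp (continuous_fst.prodMk (continuous_subtype_val.comp continuous_snd))⟩
  refine ⟨⟨fun z => L (H z), L.continuous.comp H.continuous⟩, fun φ => ?_⟩
  set χ := multiPow (tderiv (cube c r)) (fun _ => 2 + m) φ with hχ
  have hint : Integrable fun z => χ z • H z :=
    (χ.continuous.smul H.continuous).integrable_of_hasCompactSupport χ.hasCompactSupport.smul_right
  have hA : A φ = ∫ z, χ z • H z := by
    refine ContinuousMap.ext fun x => ?_
    rw [ContinuousMap.integral_apply hint]
    let ι : 𝓓(cube c r, ℝ) →ₗ[ℝ] 𝓓((⊤ : Opens (Fin n → ℝ)), ℝ) :=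
      (TestFunction.monoCLM ℝ).toLinearMap
    have hι : ∀ ψ : 𝓓(cube c r, ℝ), (ι ψ : (Fin n → ℝ) → ℝ) = ψ := fun ψ => by
      change (TestFunction.monoCLM ℝ ψ : 𝓓((⊤ : Opens (Fin n → ℝ)), ℝ)) = (ψ : (Fin n → ℝ) → ℝ)
      simp
    have hιd : ∀ k (ψ : 𝓓(cube c r, ℝ)), ι (tderiv _ k ψ) = tderiv ⊤ k (ι ψ) := fun k ψ =>
      TestFunction.ext fun y => by rw [hι, tderiv_apply, tderiv_apply, hι]
    have h1 := integral_rampKernel_mul (ι (multiPow (tderiv _) (fun _ => m) φ)) x.1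
    rw [← multiPow_intertwine ι hιd, ← Module.End.mul_apply, ← multiPow_add commute_tderiv,
      hι, hι] at h1
    refine h1.symm.trans (integral_congr_ae (Filter.Eventually.of_forall fun z => ?_))
    exact mul_comm _ _
  have hT : T φ = L (A φ) := (hL φ).symm
  rw [hT, hA, ← L.integral_comp_comm hint]
  refine integral_congr_ae (Filter.Eventually.of_forall fun z => ?_)
  simp

theorem exists_eq_multiPow_lamLin {U : Opens (Fin n → ℝ)} (T : 𝓓'(U, ℝ)) {x : Fin n → ℝ}
    (hx : x ∈ U) : ∃ (r : ℝ) (_ : 0 < r) (_ : cube x r ≤ U) (α : Fin n → ℕ)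
      (f : C(cube x r, ℝ)),
      distRes U (cube x r) T = multiPow (fun k => dderivLin k (cube x r)) α (lamLin _ f) := by
  obtain ⟨R, hR, hRU⟩ := exists_cube_le hx
  have hr : 0 < R / 2 := half_pos hR
  have hU : Metric.closedBall x (R / 2) ⊆ U :=
    (Metric.closedBall_subset_ball (half_lt_self hR)).trans hRU
  obtain ⟨m, C, hC⟩ := exists_bound U hr hU T
  obtain ⟨f, hf⟩ := exists_integral_representation (distRes U (cube x (R / 2)) T) m C hC
  -- The sign of `D^α` for `α = (2 + m, …, 2 + m)`; putting it into the function cancels it, since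
  -- `a * a = 1`.
  let a : ℝ := (-1) ^ (∑ _k : Fin n, (2 + m))
  let g : C(cube x (R / 2), ℝ) := ⟨fun y => f y.1, f.continuous.comp continuous_subtype_val⟩
  refine ⟨R / 2, hr, Metric.ball_subset_closedBall.trans hU, fun _ => 2 + m, a • g, ?_⟩
  refine ContinuousLinearMap.ext fun φ => ?_
  refine (hf φ).trans ((multiPow_dderivLin_apply _ _ φ).trans ?_).symm
  rw [map_smul]
  change a * (a * regular g _) = _
  rw [← mul_assoc, ← mul_pow, neg_one_mul, neg_neg, one_pow, one_mul, regular_apply]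
  refine integral_congr_ae (Filter.Eventually.of_forall fun y => ?_)
  by_cases hy : y ∈ cube x (R / 2)
  · simp only [zeroExt_apply g hy]
    rfl
  · simp only [test_eq_zero _ hy, zero_mul]

theorem distTriple_locallyDeriv : (distTriple.{u} n).LocallyDeriv := fun U a x hx => by
  obtain ⟨r, hr, hU, α, f, h⟩ := exists_eq_multiPow_lamLin (U := U) a.down hx
  exact ⟨_, hU, isInterval_cube x hr, mem_cube_self x hr, α, f,
    (congrArg ULift.up h).trans (distTriple_multiPow _ α _).symm⟩

/-! ## Distributions form a sheaf -/

/-- A finite smooth partition of unity on `K` subordinate to the family `V`. -/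
structure SmoothPartition {ι : Type*} (V : ι → Opens (Fin n → ℝ)) (K : Set (Fin n → ℝ)) where
  index : Finset ι
  toFun : ι → (Fin n → ℝ) → ℝ
  contDiff : ∀ i, ContDiff ℝ (⊤ : ℕ∞) (toFun i)
  tsupport_subset : ∀ i, tsupport (toFun i) ⊆ V i
  sum_eq_one : ∀ x ∈ K, ∑ i ∈ index, toFun i x = 1

open scoped Manifold ContDiff in
theorem SmoothPartition.nonempty {ι : Type*} (V : ι → Opens (Fin n → ℝ)) {K : Set (Fin n → ℝ)}
    (hK : IsCompact K) (hV : ∀ x ∈ K, ∃ i, x ∈ V i) : Nonempty (SmoothPartition V K) := by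
  obtain ⟨f, hf⟩ := SmoothPartitionOfUnity.exists_isSubordinate 𝓘(ℝ, Fin n → ℝ) hK.isClosed
    (fun i => (V i : Set (Fin n → ℝ))) (fun i => (V i).isOpen) fun x hx => mem_iUnion.2 (hV x hx)
  have hfin := f.locallyFinite.finite_nonempty_inter_compact hK
  refine ⟨⟨hfin.toFinset, fun i => f i, fun i => (f i).contMDiff.contDiff, hf, fun x hx => ?_⟩⟩
  rw [← f.sum_eq_one hx, finsum_eq_sum_of_support_subset]
  intro i hi
  simp only [Finite.coe_toFinset, mem_ofPred_eq]
  exact ⟨x, hi, hx⟩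

/-! ### Multiplication of test functions by cut-offs -/

section Multiplication

variable {χ : (Fin n → ℝ) → ℝ}

/-- Multiplication of test functions supported in `K` by a smooth function `χ`. -/
def mulSupportedIn (K : Compacts (Fin n → ℝ)) (hχ : ContDiff ℝ (⊤ : ℕ∞) χ) :
    𝓓^{⊤}_{K}(Fin n → ℝ, ℝ) →L[ℝ]
      𝓓^{⊤}_{⟨K ∩ tsupport χ, K.isCompact.inter_right (isClosed_tsupport χ)⟩}(Fin n → ℝ, ℝ) where
  toFun φ := .of_support_subset (f := fun x => φ x * χ x) (φ.contDiff.mul hχ) fun x hx =>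
    ⟨φ.support_subset (left_ne_zero_of_mul hx), subset_tsupport χ (right_ne_zero_of_mul hx)⟩
  map_add' φ ψ := ContDiffMapSupportedIn.ext fun x => add_mul _ _ _
  map_smul' c φ := ContDiffMapSupportedIn.ext fun x => mul_assoc _ _ _
  cont := by
    refine (ContDiffMapSupportedIn.continuous_iff_comp _).2 fun i => ?_
    have := (ContDiffMapSupportedIn.structureMapCLM ℝ (⊤ : ℕ∞) i).continuous.comp
      (ContDiffMapSupportedIn.bilinLeftCLM (K := K) (ContinuousLinearMap.mul ℝ ℝ) hχ).continuous
    refine this.congr fun φ => ?_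
    ext x : 1
    simp only [Function.comp_apply, ContDiffMapSupportedIn.structureMapCLM_apply]
    rfl

variable {U V : Opens (Fin n → ℝ)}

/-- Multiplication of test functions on `U` by a smooth function `χ` whose support inside `U`
is contained in `V`. -/
def mulTest (hχ : ContDiff ℝ (⊤ : ℕ∞) χ) (h : (U : Set (Fin n → ℝ)) ∩ tsupport χ ⊆ V) :
    𝓓(U, ℝ) →L[ℝ] 𝓓(V, ℝ) :=
  TestFunction.limitCLM ℝ
    (fun φ => ⟨fun x => φ x * χ x, φ.contDiff.mul hχ, φ.hasCompactSupport.mul_right,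
      fun _ hx => h ⟨φ.tsupport_subset (tsupport_mul_subset_left hx),
        tsupport_mul_subset_right hx⟩⟩)
    (fun K hK => (TestFunction.ofSupportedInCLM ℝ
        ((inter_subset_inter_left (tsupport χ) hK).trans h)).comp
      (mulSupportedIn K hχ))
    fun _ _ _ => rfl

theorem monoCLM_apply_of_le (h : V ≤ U) (φ : 𝓓(V, ℝ)) (x : Fin n → ℝ) :
    (TestFunction.monoCLM ℝ φ : 𝓓(U, ℝ)) x = φ x := by
  simp [h]

/-- A distribution is the sum of its localizations by a smooth partition of unity. -/
theorem apply_eq_sum {ι : Type*} {W : ι → Opens (Fin n → ℝ)} {φ : 𝓓(U, ℝ)} {K : Set (Fin n → ℝ)}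
    (hφ : tsupport φ ⊆ K) (P : SmoothPartition W K) (T : 𝓓'(U, ℝ)) (ψ : ∀ i, 𝓓(U ⊓ W i, ℝ))
    (hψ : ∀ i x, ψ i x = φ x * P.toFun i x) :
    T φ = ∑ i ∈ P.index, distRes U (U ⊓ W i) T (ψ i) := by
  simp only [distRes_apply]
  rw [← map_sum]
  refine congrArg T (TestFunction.ext fun x => ?_)
  have hsum : (∑ i ∈ P.index, TestFunction.monoCLM ℝ (ψ i) : 𝓓(U, ℝ)) x =
      ∑ i ∈ P.index, φ x * P.toFun i x := by
    rw [sum_apply]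
    refine Finset.sum_congr rfl fun i _ => ?_
    rw [monoCLM_apply_of_le inf_le_left, hψ]
  rw [hsum, ← Finset.mul_sum]
  by_cases hx : x ∈ tsupport φ
  · rw [P.sum_eq_one x (hφ hx), mul_one]
  · rw [image_eq_zero_of_notMem_tsupport hx, zero_mul]

end Multiplication

/-! ### Gluing distributions -/

section Gluing

variable {ι : Type*} {U : Opens (Fin n → ℝ)} {V : ι → Opens (Fin n → ℝ)}

theorem distRes_distRes {W₁ W₂ : Opens (Fin n → ℝ)} (h₁ : W₁ ≤ U) (h₂ : W₂ ≤ W₁) (T : 𝓓'(U, ℝ)) :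
    distRes W₁ W₂ (distRes U W₁ T) = distRes U W₂ T := by
  ext φ
  simp only [distRes_apply]
  refine congrArg T (TestFunction.ext fun x => ?_)
  rw [monoCLM_apply_of_le h₁, monoCLM_apply_of_le h₂, monoCLM_apply_of_le (h₂.trans h₁)]

theorem dist_eq_of_distRes_eq (hU : ∀ x ∈ U, ∃ i, x ∈ V i) (hV : ∀ i, V i ≤ U) {S T : 𝓓'(U, ℝ)}
    (h : ∀ i, distRes U (V i) S = distRes U (V i) T) : S = T := by
  ext φ
  obtain ⟨P⟩ := SmoothPartition.nonempty V φ.hasCompactSupport.isCompact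
    fun x hx => hU x (φ.tsupport_subset hx)
  let ψ : ∀ i, 𝓓(U ⊓ V i, ℝ) := fun i =>
    mulTest (P.contDiff i) (inter_subset_inter_right _ (P.tsupport_subset i)) φ
  rw [apply_eq_sum subset_rfl P S ψ fun _ _ => rfl, apply_eq_sum subset_rfl P T ψ fun _ _ => rfl]
  refine Finset.sum_congr rfl fun i _ => ?_
  rw [← distRes_distRes (hV i) inf_le_right, h, distRes_distRes (hV i) inf_le_right]

/-- The distribution `φ ↦ ∑ Tᵢ (χᵢ φ)` for a partition of unity `χ`. -/
def SmoothPartition.glue {K : Set (Fin n → ℝ)} (P : SmoothPartition V K) (T : ∀ i, 𝓓'(V i, ℝ)) :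
    𝓓(U, ℝ) →L[ℝ] ℝ :=
  ∑ i ∈ P.index, (show 𝓓(V i, ℝ) →L[ℝ] ℝ from T i).comp
    (mulTest (P.contDiff i) (inter_subset_right.trans (P.tsupport_subset i)))

theorem SmoothPartition.glue_apply {K : Set (Fin n → ℝ)} (P : SmoothPartition V K)
    (T : ∀ i, 𝓓'(V i, ℝ)) (φ : 𝓓(U, ℝ)) : P.glue T φ = ∑ i ∈ P.index,
      T i (mulTest (P.contDiff i) (inter_subset_right.trans (P.tsupport_subset i)) φ) := by
  rw [SmoothPartition.glue, sum_apply]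
  rfl

/-- Both sides refine to the double sum over the products of the two partitions; a product is
supported in `V i ⊓ V j`, where `T i` and `T j` agree. -/
theorem SmoothPartition.glue_eq_glue {T : ∀ i, 𝓓'(V i, ℝ)}
    (hT : ∀ i j, distRes (V i) (V i ⊓ V j) (T i) = distRes (V j) (V i ⊓ V j) (T j))
    {K L : Set (Fin n → ℝ)} (P : SmoothPartition V K) (Q : SmoothPartition V L) {φ : 𝓓(U, ℝ)}
    (hK : tsupport φ ⊆ K) (hL : tsupport φ ⊆ L) : P.glue T φ = Q.glue T φ := by
  have hs : ∀ i j, (U : Set (Fin n → ℝ)) ∩ tsupport (fun x => P.toFun i x * Q.toFun j x) ⊆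
      (V i ⊓ V j : Opens (Fin n → ℝ)) := fun i j x hx =>
    ⟨P.tsupport_subset i (tsupport_mul_subset_left hx.2),
      Q.tsupport_subset j (tsupport_mul_subset_right hx.2)⟩
  let ψ : ∀ i j, 𝓓(V i ⊓ V j, ℝ) := fun i j =>
    mulTest ((P.contDiff i).mul (Q.contDiff j)) (hs i j) φ
  let ψ' : ∀ j i, 𝓓(V j ⊓ V i, ℝ) := fun j i =>
    mulTest ((P.contDiff i).mul (Q.contDiff j)) (fun x hx => (hs i j hx).symm) φ
  rw [P.glue_apply, Q.glue_apply]
  have h1 : ∀ i, T i (mulTest (P.contDiff i) (inter_subset_right.trans (P.tsupport_subset i)) φ) =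
      ∑ j ∈ Q.index, distRes (V i) (V i ⊓ V j) (T i) (ψ i j) := fun i =>
    apply_eq_sum (tsupport_mul_subset_left.trans hL) Q (T i) (ψ i) fun j x => (mul_assoc _ _ _).symm
  have h2 : ∀ j, T j (mulTest (Q.contDiff j) (inter_subset_right.trans (Q.tsupport_subset j)) φ) =
      ∑ i ∈ P.index, distRes (V j) (V j ⊓ V i) (T j) (ψ' j i) := fun j =>
    apply_eq_sum (tsupport_mul_subset_left.trans hK) P (T j) (ψ' j) fun i x => by
      change φ x * (P.toFun i x * Q.toFun j x) = φ x * Q.toFun j x * P.toFun i x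
      ring
  simp only [h1, h2]
  rw [Finset.sum_comm]
  refine Finset.sum_congr rfl fun j _ => Finset.sum_congr rfl fun i _ => ?_
  rw [hT]
  simp only [distRes_apply]
  refine congrArg (T j) (TestFunction.ext fun x => ?_)
  rw [monoCLM_apply_of_le inf_le_right, monoCLM_apply_of_le inf_le_left]
  rfl

theorem exists_distRes_eq (hU : ∀ x ∈ U, ∃ i, x ∈ V i) (hV : ∀ i, V i ≤ U)
    {T : ∀ i, 𝓓'(V i, ℝ)}
    (hT : ∀ i j, distRes (V i) (V i ⊓ V j) (T i) = distRes (V j) (V i ⊓ V j) (T j)) :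
    ∃ S : 𝓓'(U, ℝ), ∀ i, distRes U (V i) S = T i := by
  have hP : ∀ K : Compacts (Fin n → ℝ), (K : Set (Fin n → ℝ)) ⊆ U →
      Nonempty (SmoothPartition V (K : Set (Fin n → ℝ))) := fun K hK =>
    SmoothPartition.nonempty V K.isCompact fun x hx => hU x (hK hx)
  let P : ∀ φ : 𝓓(U, ℝ), SmoothPartition V (tsupport φ) := fun φ =>
    (hP ⟨tsupport φ, φ.hasCompactSupport.isCompact⟩ φ.tsupport_subset).some
  have hglue : ∀ {K : Set (Fin n → ℝ)} (Q : SmoothPartition V K) (φ : 𝓓(U, ℝ)), tsupport φ ⊆ K →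
      (P φ).glue T φ = Q.glue T φ := fun Q φ hφ =>
    SmoothPartition.glue_eq_glue hT _ Q subset_rfl hφ
  -- The partition varies with `φ`, but the value does not depend on it. Additivity is checked with
  -- one partition for the union of the two supports, and continuity with one fixed partition for
  -- each compact `K`.
  let S : 𝓓(U, ℝ) →L[ℝ] ℝ := TestFunction.mkCLM ℝ (fun φ => (P φ).glue T φ)
    (fun φ ψ => by
      obtain ⟨Q⟩ := hP (⟨tsupport φ, φ.hasCompactSupport.isCompact⟩ ⊔
        ⟨tsupport ψ, ψ.hasCompactSupport.isCompact⟩)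
        (union_subset φ.tsupport_subset ψ.tsupport_subset)
      rw [hglue Q (φ + ψ) (tsupport_add φ ψ), hglue Q φ subset_union_left,
        hglue Q ψ subset_union_right, map_add])
    (fun c φ => by
      rw [hglue (P φ) (c • φ) (tsupport_smul_subset_right (fun _ => c) φ), map_smul])
    (fun K hK => by
      obtain ⟨Q⟩ := hP K hK
      refine ((Q.glue (U := U) T).continuous.comp
        (TestFunction.continuous_ofSupportedIn hK)).congr fun φ => ?_
      exact (hglue Q _ φ.tsupport_subset).symm)
  refine ⟨S, fun i => ?_⟩
  ext φ
  let φ' : 𝓓(U, ℝ) := TestFunction.monoCLM ℝ φ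
  have hφ' : (φ' : (Fin n → ℝ) → ℝ) = φ := funext (monoCLM_apply_of_le (hV i) φ)
  change (P φ').glue T φ' = T i φ
  rw [SmoothPartition.glue_apply]
  let ψ : ∀ j, 𝓓(V i ⊓ V j, ℝ) := fun j =>
    mulTest ((P φ').contDiff j) (inter_subset_inter_right _ ((P φ').tsupport_subset j)) φ
  rw [apply_eq_sum (K := tsupport φ') (by rw [hφ']) (P φ') (T i) ψ fun _ _ => rfl]
  refine Finset.sum_congr rfl fun j _ => ?_
  rw [hT, distRes_apply]
  refine congrArg (T j) (TestFunction.ext fun x => ?_)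
  rw [monoCLM_apply_of_le inf_le_right]
  exact congrArg (· * (P φ').toFun j x) (congrFun hφ' x)

end Gluing

theorem distTriple_isSheaf : (distTriple.{u} n).H.IsSheaf := by
  rw [TopCat.Presheaf.isSheaf_iff_isSheafUniqueGluing]
  intro ι V s hs
  have hU : ∀ x ∈ iSup V, ∃ i, x ∈ V i := fun x hx => Opens.mem_iSup.1 hx
  have hV : ∀ i, V i ≤ iSup V := le_iSup V
  obtain ⟨S, hS⟩ := exists_distRes_eq (n := n) hU hV (T := fun i => (s i).down)
    fun i j => congrArg ULift.down (hs i j)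
  refine ⟨ULift.up S, fun i => congrArg ULift.up (hS i), fun S' hS' => ?_⟩
  refine congrArg ULift.up (dist_eq_of_distRes_eq (n := n) hU hV fun i => ?_)
  exact (congrArg ULift.down (hS' i)).trans (hS i).symm

end UnivDistr

end

/-! ### Assembly of the co-universal property -/

theorem mainTheorem1 (n : ℕ) :
    UnivDistr.IsCoUniversalSolution (UnivDistr.Triple.IsSolution (n := n))
      UnivDistr.Triple.Preserves (UnivDistr.distTriple.{u} n) where
  comp A B D f g hf hg := by
    refine ⟨?_, fun k => ?_⟩
    · change A.j ≫ UnivDistr.Triple.toNat f ≫ UnivDistr.Triple.toNat g = D.j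
      rw [← Category.assoc, hf.1, hg.1]
    · change A.δ k ≫ UnivDistr.Triple.toNat f ≫ UnivDistr.Triple.toNat g =
        (UnivDistr.Triple.toNat f ≫ UnivDistr.Triple.toNat g) ≫ D.δ k
      rw [← Category.assoc, hf.2 k, Category.assoc, hg.2 k, Category.assoc]
  id A := ⟨Category.comp_id A.j, fun k => (Category.comp_id _).trans (Category.id_comp _).symm⟩
  solution := UnivDistr.distTriple_isSolution UnivDistr.distTriple_isSheaf
  existsUnique B hB := UnivDistr.Triple.existsUnique_preserves
    (UnivDistr.distTriple_isSolution UnivDistr.distTriple_isSheaf)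
    UnivDistr.distTriple_locallyDeriv UnivDistr.distTriple_minimalKernel hB
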